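/- Let $V$ be a real function that is continuous on $[-1,1]$. Let $m$ be an equilibrium measure of $V$, i.e. a minimizer of $$\mathcal E[m]=\int_{-\pi}^{\pi}V(\cos\lambda)\,m(d\lambda)-\int_{-\pi}^{\pi}\int_{-\pi}^{\pi}\log|e^{i\lambda}-e^{i\mu}|\,m(d\lambda)\,m(d\mu)$$ (with values in $(-\infty,+\infty]$) among all unit measures on $[-\pi,\pi]$. Let $\rho$ be a version of the Lebesgue density of $m$ (the density of its absolutely continuous part; $m$ is not assumed to be absolutely continuous), and put $$u(\lambda)=V(\cos\lambda)-2\int_{-\pi}^{\pi}\log|e^{i\lambda}-e^{i\mu}|\,m(d\mu)\in(-\infty,+\infty].$$ Let $0<\theta<\pi$ and assume: * **C1.** The support of $m$ is $\sigma=[-\theta,\theta]$. * **C2.** $\rho$ has no zeros in $(-\theta,\theta)$; there is $C>0$ with $\rho(\lambda)\sim C|\lambda\mp\theta|^{1/2}$ as $\lambda\to\pm\theta$ from inside $(-\theta,\theta)$; and for $\lambda\in[-\pi,\pi]$ the function $u$ attains its minimum over $[-\pi,\pi]$ at $\lambda$ if and only if $\lambda\in\sigma$. * **C3.** For some $\varepsilon>0$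 the function $\lambda\mapsto V(\cos\lambda)$ possesses four bounded derivatives on $[-\theta-\varepsilon,\theta+\varepsilon]$. For $\lambda\in\sigma$ put $$\chi(\lambda)=\sqrt{|\cos\lambda-\cos\theta|},\qquad P(\lambda)=\int_{-\theta}^{\theta}\frac{(V(\cos\mu))'-(V(\cos\lambda))'}{\sin\frac{\mu-\lambda}{2}}\,\frac{d\mu}{\chi(\mu)},$$ where $(V(\cos\lambda))'=\frac{d}{d\lambda}V(\cos\lambda)$. Then the integral defining $P(\lambda)$ converges absolutely for every $\lambda\in\sigma$, the measure $m$ is absolutely continuous, and its density is $$\rho(\lambda)=\frac1{4\pi^2}\,\chi(\lambda)\,P(\lambda)\,\mathbf 1_{\sigma}(\lambda),$$ the equality holding for almost every $\lambda\in\mathbb R$ and at every point $\lambda$ at which $\rho$ is continuous. -/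

import Mathlib

open Set Filter Topology MeasureTheory

noncomputable section

namespace UnitaryEquilibrium

/-- The chordal distance `|e^{iλ} - e^{iμ}|`. -/
def chord (x y : ℝ) : ℝ := ‖Complex.exp (Complex.I * x) - Complex.exp (Complex.I * y)‖

/-- The kernel `log (2 / |e^{iλ} - e^{iμ}|) = log 2 - log |e^{iλ} - e^{iμ}|`, which is non-negative
because chords have length at most `2`, with its true value `+∞` where `e^{iλ} = e^{iμ}`. -/
def logKernel (x y : ℝ) : ENNReal :=
  if chord x y = 0 then ⊤ else ENNReal.ofReal (Real.log (2 / chord x y))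

/-- `-∫ log |e^{iλ} - e^{iμ}| m(dμ)`, with values in `(-∞, +∞]`, for a unit measure `m`. -/
def logPotential (m : Measure ℝ) (x : ℝ) : EReal :=
  ((∫⁻ y, logKernel x y ∂m : ENNReal) : EReal) - ((Real.log 2 : ℝ) : EReal)

/-- `-∫∫ log |e^{iλ} - e^{iμ}| m(dλ) m(dμ)`, with values in `(-∞, +∞]`, for a unit measure `m`. -/
def logEnergy (m : Measure ℝ) : EReal :=
  ((∫⁻ x, ∫⁻ y, logKernel x y ∂m ∂m : ENNReal) : EReal) - ((Real.log 2 : ℝ) : EReal)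

/-- The functional `∫ V(cos λ) m(dλ) - ∫∫ log |e^{iλ} - e^{iμ}| m(dλ) m(dμ)`. -/
def energy (V : ℝ → ℝ) (m : Measure ℝ) : EReal :=
  ((∫ x, V (Real.cos x) ∂m : ℝ) : EReal) + logEnergy m

/-- `m` is a unit measure on `[-π, π]`. -/
def IsUnitMeasure (m : Measure ℝ) : Prop :=
  IsProbabilityMeasure m ∧ m (Icc (-Real.pi) Real.pi)ᶜ = 0

/-- `m` is an equilibrium measure of `V`: it minimizes the energy among the unit measures
on `[-π, π]`. -/
def IsEquilibriumMeasure (V : ℝ → ℝ) (m : Measure ℝ) : Prop :=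
  IsUnitMeasure m ∧ ∀ m' : Measure ℝ, IsUnitMeasure m' → energy V m ≤ energy V m'

/-- `ρ` is a version of the Lebesgue density (Radon–Nikodym derivative) of `m`. The measure `m`
is not required to be absolutely continuous. -/
def IsDensityVersion (m : Measure ℝ) (ρ : ℝ → ℝ) : Prop :=
  ρ =ᵐ[volume] fun x => (m.rnDeriv volume x).toReal

/-- The function `u(λ) = V(cos λ) - 2 ∫ log |e^{iλ} - e^{iμ}| m(dμ)`. -/
def effectivePotential (V : ℝ → ℝ) (m : Measure ℝ) (x : ℝ) : EReal :=
  ((V (Real.cos x) : ℝ) : EReal) + 2 * logPotential m x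

/-- The support of `m` is the interval `[-θ, θ]`, where `0 < θ < π`. -/
def ConditionC1 (m : Measure ℝ) (θ : ℝ) : Prop :=
  0 < θ ∧ θ < Real.pi ∧ m.support = Icc (-θ) θ

/-- `ρ` has no zeros in `(-θ, θ)`, it vanishes like `C |λ ∓ θ|^{1/2}` at the two ends of this
interval, and `u` attains its minimum over `[-π, π]` exactly on `[-θ, θ]`. -/
def ConditionC2 (V : ℝ → ℝ) (m : Measure ℝ) (ρ : ℝ → ℝ) (θ : ℝ) : Prop :=
  (∀ x ∈ Ioo (-θ) θ, ρ x ≠ 0) ∧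
  (∃ C : ℝ, 0 < C ∧
    Tendsto (fun x => ρ x / Real.sqrt |x - θ|) (𝓝[<] θ) (𝓝 C) ∧
    Tendsto (fun x => ρ x / Real.sqrt |x + θ|) (𝓝[>] (-θ)) (𝓝 C)) ∧
  ∀ x ∈ Icc (-Real.pi) Real.pi,
    (IsMinOn (effectivePotential V m) (Icc (-Real.pi) Real.pi) x ↔ x ∈ Icc (-θ) θ)

/-- `V(cos λ)` possesses four bounded derivatives on `[-θ - ε, θ + ε]` for some `ε > 0`. -/
def ConditionC3 (V : ℝ → ℝ) (θ : ℝ) : Prop :=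
  ∃ ε : ℝ, 0 < ε ∧
    (∀ k : ℕ, k < 4 → DifferentiableOn ℝ
      (iteratedDerivWithin k (fun x => V (Real.cos x)) (Icc (-θ - ε) (θ + ε)))
      (Icc (-θ - ε) (θ + ε))) ∧
    ∃ M : ℝ, ∀ k : ℕ, k ≤ 4 → ∀ x ∈ Icc (-θ - ε) (θ + ε),
      |iteratedDerivWithin k (fun x => V (Real.cos x)) (Icc (-θ - ε) (θ + ε)) x| ≤ M

/-- `χ(λ) = √|cos λ - cos θ|`. -/
def chi (θ x : ℝ) : ℝ := Real.sqrt |Real.cos x - Real.cos θ|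

/-- The integrand of `P(λ)`, as a function of `μ = y`, at `λ = x`. -/
def integrandP (V : ℝ → ℝ) (θ x y : ℝ) : ℝ :=
  (deriv (fun t => V (Real.cos t)) y - deriv (fun t => V (Real.cos t)) x) /
    Real.sin ((y - x) / 2) * (1 / chi θ y)

/-- `P(λ) = ∫_{-θ}^{θ} ((V(cos μ))' - (V(cos λ))') / sin((μ - λ)/2) dμ / χ(μ)`. -/
def P (V : ℝ → ℝ) (θ x : ℝ) : ℝ := ∫ y in (-θ)..θ, integrandP V θ x y

/-- `(1 / 4π²) χ(λ) P(λ) 1_σ(λ)` with `σ = [-θ, θ]`. -/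
def densityFormula (V : ℝ → ℝ) (θ : ℝ) : ℝ → ℝ :=
  (Icc (-θ) θ).indicator fun x => 1 / (4 * Real.pi ^ 2) * chi θ x * P V θ x

end UnitaryEquilibrium

end

/-!
Why the formula holds. Put `f(x) = V (cos x)`. The effective potential is constant on the arc
`[-θ, θ]`, because every point of the arc is a minimizer, and the constant is finite, because
otherwise every point of `[-π, π]` would be a minimizer. So the logarithmic potential of `m`
equals `(f - ℓ) / 2` at every point of the arc (`exists_hasLogPotentialOn`). From there on, the
only facts used about `m` are this integral equation, the unit mass and the square-root vanishing
of `ρ` at the ends.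

The equation on an interval is solved by Chebyshev polynomials: the kernel `log |cos x - cos y|`
on `[0, π]` has the eigenfunctions `cos (n x)` (`integral_log_abs_cos_sub_cos_mul_cos`), so that a
logarithmic potential determines all cosine moments of its measure (`integral_potential_mul_cos`),
and these determine the measure (`ext_of_integral_cos_eq`). This is used twice. In the coordinate
`tan (x / 2)` it gives uniqueness on the arc, hence the evenness of `m`
(`HasLogPotentialOn.map_neg_eq`). For an even measure, `|2 sin ((x - y) / 2)|` may then be
replaced by `2 |sin (x / 2) - sin (y / 2)|`, and in the coordinate `sin (x / 2) = a cos φ`, where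
`a = sin (θ / 2)`, the moments become explicit (`integral_cos_arcAngle`). Three derivatives of `f`
make them summable, so `m` has a continuous density `h(φ) = (1 / π) (1 + 2 ∑ b n cos (n φ))` in
the variable `φ` (`eq_withDensity_cosSeries`).

To sum the series, let `R` be the derivative of `f` with respect to `sin (x / 2)`, up to a factor
`2`. Integration by parts turns `b n` into a difference of two cosine coefficients of `R`, and the
cosine coefficients of `q(ψ) = (R ψ - R φ) / (cos ψ - cos φ)` satisfy a three-term recursion whose
right-hand sides are those of `R`; so the partial sums of the series telescope, and the boundary
terms vanish by the Riemann–Lebesgue lemma. The square-root behaviour of `ρ` forces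
`h(0) = h(π) = 0`, which leaves `h(φ) = (a / π²) sin² φ ∫ q` (`cosSeries_eq_of_eq_zero`). Symmetrization in `y`,
together with the oddness of `f'`, identifies `∫ q` with `P`, up to an explicit factor
(`P_eq_integral_reducedQuotient`).
-/

open Set Filter Topology MeasureTheory

noncomputable section

namespace UnitaryEquilibrium

/-! ### The cosine transform of the logarithmic kernel -/

theorem integral_cos_nat_mul {n : ℕ} (hn : n ≠ 0) :
    ∫ t in (0 : ℝ)..Real.pi, Real.cos (n * t) = 0 := by
  have hn' : (n : ℝ) ≠ 0 := by exact_mod_cast hn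
  rw [intervalIntegral.integral_comp_mul_left (fun t => Real.cos t) hn']
  simp [Real.sin_nat_mul_pi]

/-- The conjugate Dirichlet kernel `sin (n t) cot (t / 2)` has integral `π` over `[0, π]`. -/
theorem integral_sin_mul_cot_half (n : ℕ) :
    IntervalIntegrable (fun t : ℝ => Real.sin ((n + 1 : ℕ) * t) *
      (Real.cos (t / 2) / Real.sin (t / 2))) volume 0 Real.pi ∧
    ∫ t in (0 : ℝ)..Real.pi, Real.sin ((n + 1 : ℕ) * t) *
      (Real.cos (t / 2) / Real.sin (t / 2)) = Real.pi := by
  have hpos : ∀ t ∈ Ioo (0 : ℝ) Real.pi, Real.sin (t / 2) ≠ 0 := fun t ht =>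
    (Real.sin_pos_of_pos_of_lt_pi (by linarith [ht.1]) (by linarith [ht.1, ht.2])).ne'
  have hstep : ∀ k : ℕ, ∀ t ∈ Ioo (0 : ℝ) Real.pi,
      Real.sin ((k + 1 : ℕ) * t) * (Real.cos (t / 2) / Real.sin (t / 2)) =
      Real.sin (k * t) * (Real.cos (t / 2) / Real.sin (t / 2)) +
        (Real.cos ((k + 1 : ℕ) * t) + Real.cos (k * t)) := by
    intro k t ht
    have h0 := hpos t ht
    have e1 : ((k + 1 : ℕ) : ℝ) * t = k * t + 2 * (t / 2) := by push_cast; ring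
    rw [e1, Real.sin_add, Real.cos_add, Real.sin_two_mul, Real.cos_two_mul]
    field_simp
    linear_combination (2 * Real.sin (k * t) * Real.cos (t / 2)) * Real.sin_sq_add_cos_sq (t / 2)
  have hcont : ∀ k : ℕ, IntervalIntegrable
      (fun t : ℝ => Real.cos ((k + 1 : ℕ) * t) + Real.cos (k * t)) volume 0 Real.pi := fun k =>
    Continuous.intervalIntegrable (by fun_prop) _ _
  have hval : ∀ k : ℕ, ∫ t in (0 : ℝ)..Real.pi,
      (Real.cos ((k + 1 : ℕ) * t) + Real.cos (k * t)) = if k = 0 then Real.pi else 0 := by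
    intro k
    rw [intervalIntegral.integral_add (Continuous.intervalIntegrable (by fun_prop) _ _)
      (Continuous.intervalIntegrable (by fun_prop) _ _), integral_cos_nat_mul (Nat.succ_ne_zero k)]
    split_ifs with hk
    · simp [hk]
    · simp [integral_cos_nat_mul hk]
  have hcongr : ∀ k : ℕ, EqOn
      (fun t : ℝ => Real.sin (k * t) * (Real.cos (t / 2) / Real.sin (t / 2)) +
        (Real.cos ((k + 1 : ℕ) * t) + Real.cos (k * t)))
      (fun t : ℝ => Real.sin ((k + 1 : ℕ) * t) * (Real.cos (t / 2) / Real.sin (t / 2)))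
      (Ioo 0 Real.pi) := fun k t ht => (hstep k t ht).symm
  have key : ∀ k : ℕ, ∀ c : ℝ,
      (IntervalIntegrable (fun t : ℝ => Real.sin (k * t) *
        (Real.cos (t / 2) / Real.sin (t / 2))) volume 0 Real.pi ∧
      ∫ t in (0 : ℝ)..Real.pi, Real.sin (k * t) * (Real.cos (t / 2) / Real.sin (t / 2)) = c) →
      (IntervalIntegrable (fun t : ℝ => Real.sin ((k + 1 : ℕ) * t) *
        (Real.cos (t / 2) / Real.sin (t / 2))) volume 0 Real.pi ∧
      ∫ t in (0 : ℝ)..Real.pi, Real.sin ((k + 1 : ℕ) * t) *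
        (Real.cos (t / 2) / Real.sin (t / 2)) = c + if k = 0 then Real.pi else 0) := by
    intro k c ⟨h1, h2⟩
    have hae : ∀ᵐ t ∂(volume.restrict (Ioc (0 : ℝ) Real.pi)),
        Real.sin (k * t) * (Real.cos (t / 2) / Real.sin (t / 2)) +
        (Real.cos ((k + 1 : ℕ) * t) + Real.cos (k * t)) =
        Real.sin ((k + 1 : ℕ) * t) * (Real.cos (t / 2) / Real.sin (t / 2)) := by
      rw [← restrict_Ioo_eq_restrict_Ioc]
      exact (ae_restrict_mem measurableSet_Ioo).mono fun t ht => hcongr k ht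
    rw [← uIoc_of_le Real.pi_pos.le] at hae
    refine ⟨(h1.add (hcont k)).congr_ae hae, ?_⟩
    rw [← hval k, ← h2, ← intervalIntegral.integral_add h1 (hcont k)]
    refine intervalIntegral.integral_congr_ae ?_
    have := (ae_restrict_iff' measurableSet_uIoc).1 hae
    filter_upwards [this] with t ht hm using (ht hm).symm
  induction n with
  | zero => simpa using key 0 0 (by simp)
  | succ n ih => simpa using key (n + 1) Real.pi ih

theorem intervalIntegrable_log_two_sin_half (a b : ℝ) :
    IntervalIntegrable (fun t => Real.log (2 * Real.sin (t / 2))) volume a b := by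
  refine MeromorphicOn.intervalIntegrable_log (f := fun t => 2 * Real.sin (t / 2)) ?_
  refine AnalyticOnNhd.meromorphicOn fun x _ => ?_
  fun_prop

/-- `sin (n t) log (2 sin (t / 2))` extends continuously by `0` to the zeros of `sin (t / 2)`. -/
theorem continuous_log_two_sin_half_mul_sin (n : ℕ) :
    Continuous fun t : ℝ => Real.log (2 * Real.sin (t / 2)) * Real.sin (n * t) := by
  rw [continuous_iff_continuousAt]
  intro x
  by_cases hx : Real.sin (x / 2) = 0
  · -- Near a zero, the factor `sin (n t)` is dominated by `2 sin (t / 2)`, and `s log s → 0`.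
    have hbound : ∀ (k : ℕ) (t : ℝ), |Real.sin (k * t)| ≤ k * |2 * Real.sin (t / 2)| := by
      intro k t
      induction k with
      | zero => simp
      | succ k ih =>
        have e : Real.sin ((k + 1 : ℕ) * t) = Real.sin (k * t) * Real.cos t +
            Real.cos (k * t) * (2 * Real.sin (t / 2) * Real.cos (t / 2)) := by
          rw [← Real.sin_two_mul, mul_div_cancel₀ _ two_ne_zero, ← Real.sin_add]
          push_cast; ring_nf
        rw [e]
        have h1 : |Real.sin (k * t) * Real.cos t| ≤ |Real.sin (k * t)| := by
          rw [abs_mul]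
          exact mul_le_of_le_one_right (abs_nonneg _) (Real.abs_cos_le_one _)
        have h2 : |Real.cos (k * t) * (2 * Real.sin (t / 2) * Real.cos (t / 2))| ≤
            |2 * Real.sin (t / 2)| := by
          rw [abs_mul, abs_mul (2 * _)]
          calc _ ≤ 1 * (|2 * Real.sin (t / 2)| * 1) := by
                gcongr
                · exact Real.abs_cos_le_one _
                · exact Real.abs_cos_le_one _
            _ = _ := by ring
        calc _ ≤ _ := abs_add_le _ _
          _ ≤ k * |2 * Real.sin (t / 2)| + |2 * Real.sin (t / 2)| := by linarith
          _ = _ := by push_cast; ring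
    have h0 : Real.log (2 * Real.sin (x / 2)) * Real.sin (n * x) = 0 := by simp [hx]
    have hlim : Tendsto (fun t : ℝ => (n : ℝ) *
        |2 * Real.sin (t / 2) * Real.log (2 * Real.sin (t / 2))|) (𝓝 x) (𝓝 0) := by
      have : Continuous fun t : ℝ => (n : ℝ) *
          |2 * Real.sin (t / 2) * Real.log (2 * Real.sin (t / 2))| :=
        continuous_const.mul ((Real.continuous_mul_log.comp
          (by fun_prop : Continuous fun t : ℝ => 2 * Real.sin (t / 2))).abs)
      simpa [hx] using this.tendsto x
    rw [ContinuousAt, h0]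
    refine squeeze_zero_norm (fun t => ?_) hlim
    rw [Real.norm_eq_abs, abs_mul, abs_mul]
    nlinarith [mul_le_mul_of_nonneg_left (hbound n t)
      (abs_nonneg (Real.log (2 * Real.sin (t / 2))))]
  · refine ContinuousAt.mul (ContinuousAt.log ?_ (by simpa using hx)) ?_ <;> fun_prop

theorem integral_log_two_sin_half :
    ∫ t in (0 : ℝ)..Real.pi, Real.log (2 * Real.sin (t / 2)) = 0 := by
  have h1 : ∫ t in (0 : ℝ)..Real.pi, Real.log (2 * Real.sin (t / 2)) =
      ∫ t in (0 : ℝ)..Real.pi, (Real.log 2 + Real.log (Real.sin (t / 2))) := by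
    refine intervalIntegral.integral_congr_ae (Eventually.of_forall fun t ht => ?_)
    rw [uIoc_of_le Real.pi_pos.le] at ht
    exact Real.log_mul two_ne_zero
      (Real.sin_pos_of_pos_of_lt_pi (by linarith [ht.1]) (by linarith [ht.1, ht.2])).ne'
  have h2 : ∫ t in (0 : ℝ)..Real.pi, Real.log (Real.sin (t / 2)) = -Real.log 2 * Real.pi := by
    rw [intervalIntegral.integral_comp_div (fun t => Real.log (Real.sin t)) two_ne_zero, zero_div,
      integral_log_sin_zero_pi_div_two]
    simp; ring
  have h3 : IntervalIntegrable (fun t => Real.log (Real.sin (t / 2))) volume 0 Real.pi :=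
    MeromorphicOn.intervalIntegrable_log (f := fun t => Real.sin (t / 2))
      (AnalyticOnNhd.meromorphicOn fun x _ => by fun_prop)
  rw [h1, intervalIntegral.integral_add intervalIntegrable_const h3, h2]
  simp; ring

theorem integral_log_two_sin_half_mul_cos {n : ℕ} (hn : n ≠ 0) :
    ∫ t in (0 : ℝ)..Real.pi, Real.log (2 * Real.sin (t / 2)) * Real.cos (n * t) =
      -(Real.pi / (2 * n)) := by
  obtain ⟨k, rfl⟩ := Nat.exists_eq_succ_of_ne_zero hn
  have hn' : ((k.succ : ℕ) : ℝ) ≠ 0 := by exact_mod_cast hn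
  obtain ⟨hi, hv⟩ := integral_sin_mul_cot_half k
  have hlog : IntervalIntegrable (fun t : ℝ => Real.log (2 * Real.sin (t / 2)) *
      Real.cos ((k.succ : ℕ) * t)) volume 0 Real.pi :=
    (intervalIntegrable_log_two_sin_half 0 Real.pi).mul_continuousOn (by fun_prop)
  have key := intervalIntegral.integral_eq_sub_of_hasDerivAt_of_le (a := 0) (b := Real.pi)
    (f := fun t : ℝ => Real.log (2 * Real.sin (t / 2)) * Real.sin ((k.succ : ℕ) * t))
    (f' := fun t : ℝ => (1 / 2) * (Real.sin ((k + 1 : ℕ) * t) *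
      (Real.cos (t / 2) / Real.sin (t / 2))) +
      (k.succ : ℕ) * (Real.log (2 * Real.sin (t / 2)) * Real.cos ((k.succ : ℕ) * t)))
    Real.pi_pos.le (continuous_log_two_sin_half_mul_sin _).continuousOn ?_
    ((hi.const_mul _).add (hlog.const_mul _))
  · rw [intervalIntegral.integral_add (hi.const_mul _) (hlog.const_mul _),
      intervalIntegral.integral_const_mul, intervalIntegral.integral_const_mul, hv] at key
    simp only [Real.sin_nat_mul_pi, mul_zero, Real.sin_zero, sub_zero] at key
    field_simp at key ⊢
    linarith
  · intro t ht
    have h0 : Real.sin (t / 2) ≠ 0 :=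
      (Real.sin_pos_of_pos_of_lt_pi (by linarith [ht.1]) (by linarith [ht.1, ht.2])).ne'
    have d1 : HasDerivAt (fun t : ℝ => 2 * Real.sin (t / 2))
        (2 * (Real.cos (t / 2) * (1 / 2))) t :=
      (((hasDerivAt_id t).div_const 2).sin).const_mul 2
    have d2 : HasDerivAt (fun t : ℝ => Real.sin ((k.succ : ℕ) * t))
        (Real.cos ((k.succ : ℕ) * t) * ((k.succ : ℕ) * 1)) t :=
      ((hasDerivAt_id t).const_mul _).sin
    refine ((d1.log (by simpa using h0)).mul d2).congr_deriv ?_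
    simp only [Nat.succ_eq_add_one]
    field_simp

/-- Factorization of the difference of two cosines, on the logarithmic scale. -/
theorem log_abs_cos_sub_cos {x y : ℝ} (hxy : Real.cos x ≠ Real.cos y) :
    Real.log |Real.cos x - Real.cos y| = Real.log (2 * Real.sin ((x - y) / 2)) +
      Real.log (2 * Real.sin ((x + y) / 2)) - Real.log 2 := by
  have h := Real.cos_sub_cos x y
  have hne : Real.cos x - Real.cos y ≠ 0 := sub_ne_zero.2 hxy
  rw [h] at hne
  have h1 : Real.sin ((x + y) / 2) ≠ 0 := fun h => hne (by simp [h])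
  have h2 : Real.sin ((x - y) / 2) ≠ 0 := fun h => hne (by simp [h])
  rw [Real.log_abs, h, Real.log_mul two_ne_zero h2, Real.log_mul two_ne_zero h1,
    Real.log_mul (mul_ne_zero (by norm_num) h1) h2, Real.log_mul (by norm_num) h1,
    Real.log_neg_eq_log]
  ring

theorem intervalIntegrable_log_abs_cos_sub_cos (y a b : ℝ) :
    IntervalIntegrable (fun x => Real.log |Real.cos x - Real.cos y|) volume a b := by
  simp only [Real.log_abs]
  exact MeromorphicOn.intervalIntegrable_log (f := fun x => Real.cos x - Real.cos y)
      (AnalyticOnNhd.meromorphicOn fun x _ => by fun_prop)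

theorem ae_cos_ne_cos (y : ℝ) :
    ∀ᵐ x ∂(volume.restrict (Ioc (0 : ℝ) Real.pi)), Real.cos x ≠ Real.cos y := by
  rw [ae_restrict_iff' measurableSet_Ioc]
  have hsub : {x : ℝ | x ∈ Ioc (0 : ℝ) Real.pi ∧ Real.cos x = Real.cos y} ⊆
      {Real.arccos (Real.cos y)} := by
    rintro x ⟨hx, hxy⟩
    rw [mem_singleton_iff, ← hxy, Real.arccos_cos hx.1.le hx.2]
  have hnull : volume {x : ℝ | x ∈ Ioc (0 : ℝ) Real.pi ∧ Real.cos x = Real.cos y} = 0 :=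
    measure_mono_null hsub (by simp)
  rw [measure_eq_zero_iff_ae_notMem] at hnull
  filter_upwards [hnull] with x hx hm h using hx ⟨hm, h⟩

/-- The cosine transform of `log |cos x - cos y|` in the variable `x` reduces, through the
factorization of `cos x - cos y` and periodicity, to that of `log |2 sin (t / 2)|`. -/
theorem integral_log_abs_cos_sub_cos_mul_cos_eq (n : ℕ) (y : ℝ) :
    ∫ x in (0 : ℝ)..Real.pi, Real.log |Real.cos x - Real.cos y| * Real.cos (n * x) =
      2 * Real.cos (n * y) *
        (∫ t in (0 : ℝ)..Real.pi, Real.log (2 * Real.sin (t / 2)) * Real.cos (n * t)) -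
      Real.log 2 * ∫ x in (0 : ℝ)..Real.pi, Real.cos (n * x) := by
  set l : ℝ → ℝ := fun t => Real.log (2 * Real.sin (t / 2)) with hl
  have leven : ∀ t, l (-t) = l t := fun t => by
    simp only [hl, neg_div, Real.sin_neg, mul_neg, Real.log_neg_eq_log]
  have lper : ∀ t, l (t + 2 * Real.pi) = l t := fun t => by
    simp only [hl, add_div, mul_div_cancel_left₀ _ (two_ne_zero' ℝ), Real.sin_add_pi, mul_neg,
      Real.log_neg_eq_log]
  have lint : ∀ a b, IntervalIntegrable l volume a b := intervalIntegrable_log_two_sin_half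
  have lints : ∀ c a b, IntervalIntegrable (fun x => l (x + c)) volume a b := fun c a b => by
    simpa using (lint (a + c) (b + c)).comp_add_right c
  have lintc : ∀ c a b, IntervalIntegrable (fun x => l (x + c) * Real.cos (n * x)) volume a b :=
    fun c a b => (lints c a b).mul_continuousOn (by fun_prop)
  have step1 : ∫ x in (0 : ℝ)..Real.pi, Real.log |Real.cos x - Real.cos y| * Real.cos (n * x) =
      ∫ x in (0 : ℝ)..Real.pi, ((l (x + -y) * Real.cos (n * x) + l (x + y) * Real.cos (n * x)) -
        Real.log 2 * Real.cos (n * x)) := by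
    refine intervalIntegral.integral_congr_ae ?_
    have := (ae_restrict_iff' measurableSet_Ioc).1 (ae_cos_ne_cos y)
    rw [uIoc_of_le Real.pi_pos.le]
    filter_upwards [this] with x hx hm
    rw [log_abs_cos_sub_cos (hx hm), ← sub_eq_add_neg]
    simp only [hl]; ring
  have hc : IntervalIntegrable (fun x : ℝ => Real.cos (n * x)) volume 0 Real.pi :=
    Continuous.intervalIntegrable (by fun_prop) _ _
  rw [step1, intervalIntegral.integral_sub ((lintc _ _ _).add (lintc _ _ _)) (hc.const_mul _),
    intervalIntegral.integral_add (lintc _ _ _) (lintc _ _ _), intervalIntegral.integral_const_mul]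
  congr 1
  have step2 : ∫ x in (0 : ℝ)..Real.pi, l (x + -y) * Real.cos (n * x) =
      ∫ x in (-Real.pi)..0, l (x + y) * Real.cos (n * x) := by
    rw [← neg_zero, ← intervalIntegral.integral_comp_neg, neg_zero]
    refine intervalIntegral.integral_congr fun x _ => ?_
    simp only [mul_neg, Real.cos_neg]
    rw [← leven, neg_add, neg_neg]
  rw [step2, intervalIntegral.integral_add_adjacent_intervals (lintc _ _ _) (lintc _ _ _)]
  have step3 : ∫ x in (-Real.pi)..Real.pi, l (x + y) * Real.cos (n * x) =
      ∫ x in (-Real.pi)..Real.pi, l x * Real.cos (n * (x - y)) := by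
    have hper : Function.Periodic (fun x : ℝ => l x * Real.cos (n * (x - y))) (2 * Real.pi) := by
      intro x
      simp only [lper]
      rw [show (n : ℝ) * (x + 2 * Real.pi - y) = n * (x - y) + n * (2 * Real.pi) by ring,
        Real.cos_add_nat_mul_two_pi]
    have h1 := hper.intervalIntegral_add_eq (-Real.pi) (-Real.pi + y)
    have h2 := intervalIntegral.integral_comp_add_right
      (fun x : ℝ => l x * Real.cos (n * (x - y))) y (a := -Real.pi) (b := Real.pi)
    simp only [add_sub_cancel_right] at h2
    rw [h2, show (Real.pi : ℝ) = -Real.pi + 2 * Real.pi by ring]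
    rw [show -(-Real.pi + 2 * Real.pi) = -Real.pi by ring, h1]
    congr 1; ring
  rw [step3]
  have lc : ∀ a b, IntervalIntegrable (fun x => l x * Real.cos (n * x)) volume a b :=
    fun a b => (lint a b).mul_continuousOn (by fun_prop)
  have ls : ∀ a b, IntervalIntegrable (fun x => l x * Real.sin (n * x)) volume a b :=
    fun a b => (lint a b).mul_continuousOn (by fun_prop)
  have step4 : ∫ x in (-Real.pi)..Real.pi, l x * Real.cos (n * (x - y)) =
      Real.cos (n * y) * (∫ x in (-Real.pi)..Real.pi, l x * Real.cos (n * x)) +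
      Real.sin (n * y) * (∫ x in (-Real.pi)..Real.pi, l x * Real.sin (n * x)) := by
    rw [← intervalIntegral.integral_const_mul, ← intervalIntegral.integral_const_mul,
      ← intervalIntegral.integral_add ((lc _ _).const_mul _) ((ls _ _).const_mul _)]
    refine intervalIntegral.integral_congr fun x _ => ?_
    simp only [mul_sub, Real.cos_sub]; ring
  have reflect : ∀ g : ℝ → ℝ, ∫ x in (-Real.pi)..0, g x = ∫ x in (0 : ℝ)..Real.pi, g (-x) := by
    intro g
    rw [intervalIntegral.integral_comp_neg, neg_zero]
  have step5 : ∫ x in (-Real.pi)..Real.pi, l x * Real.sin (n * x) = 0 := by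
    rw [← intervalIntegral.integral_add_adjacent_intervals (ls _ 0) (ls 0 _), reflect]
    simp [leven]
  have step6 : ∫ x in (-Real.pi)..Real.pi, l x * Real.cos (n * x) =
      2 * ∫ x in (0 : ℝ)..Real.pi, l x * Real.cos (n * x) := by
    rw [← intervalIntegral.integral_add_adjacent_intervals (lc _ 0) (lc 0 _), reflect]
    simp only [leven, mul_neg, Real.cos_neg]; ring
  rw [step4, step5, step6]; ring

theorem integral_log_abs_cos_sub_cos (y : ℝ) :
    ∫ x in (0 : ℝ)..Real.pi, Real.log |Real.cos x - Real.cos y| = -(Real.pi * Real.log 2) := by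
  have := integral_log_abs_cos_sub_cos_mul_cos_eq 0 y
  simp only [CharP.cast_eq_zero, zero_mul, Real.cos_zero, mul_one, integral_log_two_sin_half,
    mul_zero, intervalIntegral.integral_const, sub_zero, smul_eq_mul] at this
  linarith

/-- The Chebyshev polynomials are eigenfunctions of the logarithmic kernel of an interval. -/
theorem integral_log_abs_cos_sub_cos_mul_cos {n : ℕ} (hn : n ≠ 0) (y : ℝ) :
    ∫ x in (0 : ℝ)..Real.pi, Real.log |Real.cos x - Real.cos y| * Real.cos (n * x) =
      -(Real.pi / n) * Real.cos (n * y) := by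
  have hn' : (n : ℝ) ≠ 0 := by exact_mod_cast hn
  rw [integral_log_abs_cos_sub_cos_mul_cos_eq, integral_log_two_sin_half_mul_cos hn,
    integral_cos_nat_mul hn]
  field_simp
  ring

/-! ### Measures on `[0, π]` and their cosine moments -/

theorem integrable_log_abs_cos_sub_cos_prod (κ : Measure ℝ) [IsFiniteMeasure κ] :
    Integrable (fun z : ℝ × ℝ => Real.log |Real.cos z.1 - Real.cos z.2|)
      ((volume.restrict (Ioc 0 Real.pi)).prod κ) := by
  have hmeas : Measurable fun z : ℝ × ℝ => Real.log |Real.cos z.1 - Real.cos z.2| := by fun_prop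
  have hle : ∀ x y : ℝ, Real.log |Real.cos x - Real.cos y| ≤ Real.log 2 := by
    intro x y
    rcases eq_or_ne (Real.cos x - Real.cos y) 0 with h | h
    · simp only [h, abs_zero, Real.log_zero]
      exact Real.log_nonneg one_le_two
    · refine Real.log_le_log (abs_pos.2 h) (abs_le.2 ⟨?_, ?_⟩) <;>
        linarith [Real.cos_le_one x, Real.cos_le_one y, Real.neg_one_le_cos x,
          Real.neg_one_le_cos y]
  -- The kernel is dominated by `2 log 2 - log |cos x - cos y| ≥ 0`, whose integral in `x` does not
  -- depend on `y`.
  have hdom : Integrable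
      (fun z : ℝ × ℝ => 2 * Real.log 2 - Real.log |Real.cos z.1 - Real.cos z.2|)
      ((volume.restrict (Ioc 0 Real.pi)).prod κ) := by
    have hint : ∀ y : ℝ, IntervalIntegrable
        (fun x => 2 * Real.log 2 - Real.log |Real.cos x - Real.cos y|) volume 0 Real.pi := fun y =>
      intervalIntegrable_const.sub (intervalIntegrable_log_abs_cos_sub_cos y 0 Real.pi)
    rw [integrable_prod_iff' (hmeas.const_sub _).aestronglyMeasurable]
    refine ⟨Eventually.of_forall fun y => ?_, ?_⟩
    · exact (intervalIntegrable_iff_integrableOn_Ioc_of_le Real.pi_pos.le).1 (hint y)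
    · have : (fun y : ℝ => ∫ x, ‖2 * Real.log 2 - Real.log |Real.cos x - Real.cos y|‖
          ∂(volume.restrict (Ioc 0 Real.pi))) = fun _ => 3 * Real.pi * Real.log 2 := by
        funext y
        have h1 : ∀ x : ℝ, ‖2 * Real.log 2 - Real.log |Real.cos x - Real.cos y|‖ =
            2 * Real.log 2 - Real.log |Real.cos x - Real.cos y| := fun x => by
          rw [Real.norm_of_nonneg]
          have := Real.log_nonneg one_le_two
          linarith [hle x y]
        simp only [h1]
        rw [← intervalIntegral.integral_of_le Real.pi_pos.le, intervalIntegral.integral_sub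
          intervalIntegrable_const (intervalIntegrable_log_abs_cos_sub_cos y 0 Real.pi),
          integral_log_abs_cos_sub_cos]
        simp; ring
      rw [this]
      exact integrable_const _
  refine hdom.mono' hmeas.aestronglyMeasurable (Eventually.of_forall fun z => ?_)
  rw [Real.norm_eq_abs, abs_le]
  have := hle z.1 z.2
  have := Real.log_nonneg one_le_two
  constructor <;> linarith

/-- The logarithmic potential of a measure on `[0, π]`, in the variable `cos`, determines its
cosine moments. -/
theorem integral_potential_mul_cos (κ : Measure ℝ) [IsFiniteMeasure κ] {L : ℝ → ℝ}
    (hL : ∀ x ∈ Icc 0 Real.pi, ∫ y, Real.log |Real.cos x - Real.cos y| ∂κ = L x)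
    {n : ℕ} (hn : n ≠ 0) :
    ∫ x in (0 : ℝ)..Real.pi, L x * Real.cos (n * x) =
      -(Real.pi / n) * ∫ y, Real.cos (n * y) ∂κ := by
  have h1 : ∫ x in (0 : ℝ)..Real.pi, L x * Real.cos (n * x) =
      ∫ x in (0 : ℝ)..Real.pi,
        ∫ y, Real.log |Real.cos x - Real.cos y| * Real.cos (n * x) ∂κ := by
    refine intervalIntegral.integral_congr fun x hx => ?_
    rw [uIcc_of_le Real.pi_pos.le] at hx
    rw [integral_mul_const, hL x hx]
  have hint : Integrable (Function.uncurry fun x y : ℝ =>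
      Real.log |Real.cos x - Real.cos y| * Real.cos (n * x))
      ((volume.restrict (Ioc 0 Real.pi)).prod κ) := by
    refine (integrable_log_abs_cos_sub_cos_prod κ).mul_bdd (c := 1)
      (by fun_prop : Measurable fun z : ℝ × ℝ => Real.cos (n * z.1)).aestronglyMeasurable
      (Eventually.of_forall fun z => ?_)
    simpa using Real.abs_cos_le_one _
  rw [h1, intervalIntegral.integral_of_le Real.pi_pos.le, integral_integral_swap hint]
  simp_rw [← intervalIntegral.integral_of_le Real.pi_pos.le,
    integral_log_abs_cos_sub_cos_mul_cos hn]
  rw [integral_const_mul]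

/-- The span of the Chebyshev polynomials contains `1` and, by the three-term recursion, is stable
under multiplication by `X`. -/
theorem span_chebyshev_T_eq_top :
    Submodule.span ℝ (range fun n : ℕ => Polynomial.Chebyshev.T ℝ n) = ⊤ := by
  set S := Submodule.span ℝ (range fun n : ℕ => Polynomial.Chebyshev.T ℝ n) with hS
  have hmem : ∀ n : ℕ, Polynomial.Chebyshev.T ℝ n ∈ S := fun n =>
    Submodule.subset_span ⟨n, rfl⟩
  have hX : ∀ p ∈ S, Polynomial.X * p ∈ S := by
    intro p hp
    induction hp using Submodule.span_induction with
    | mem p hp =>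
      obtain ⟨n, rfl⟩ := hp
      rcases n with _ | n
      · simpa using hmem 1
      · have h := Polynomial.Chebyshev.T_add_two ℝ (n : ℤ)
        have : Polynomial.X * Polynomial.Chebyshev.T ℝ ((n + 1 : ℕ) : ℤ) =
            (1 / 2 : ℝ) • (Polynomial.Chebyshev.T ℝ ((n + 2 : ℕ) : ℤ) +
              Polynomial.Chebyshev.T ℝ (n : ℤ)) := by
          push_cast
          rw [h, sub_add_cancel, mul_assoc, Polynomial.smul_eq_C_mul, ← mul_assoc,
            show (2 : Polynomial ℝ) = Polynomial.C 2 from rfl, ← Polynomial.C_mul]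
          norm_num
        simp only [this]
        exact S.smul_mem _ (S.add_mem (hmem _) (hmem _))
    | zero => simp
    | add p q _ _ hp hq => rw [mul_add]; exact S.add_mem hp hq
    | smul c p _ hp => rw [mul_smul_comm]; exact S.smul_mem _ hp
  have hpow : ∀ k : ℕ, (Polynomial.X : Polynomial ℝ) ^ k ∈ S := by
    intro k
    induction k with
    | zero => simpa using hmem 0
    | succ k ih => rw [pow_succ']; exact hX _ ih
  rw [eq_top_iff]
  intro p _
  rw [p.as_sum_support_C_mul_X_pow]
  exact S.sum_mem fun k _ => by
    rw [← Polynomial.smul_eq_C_mul]; exact S.smul_mem _ (hpow k)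

theorem integrable_of_continuous_of_measure_compl_Icc {κ : Measure ℝ} [IsFiniteMeasure κ]
    {a b : ℝ} (hκ : κ (Icc a b)ᶜ = 0) {F : ℝ → ℝ} (hF : ContinuousOn F (Icc a b)) :
    Integrable F κ := by
  rw [← Measure.restrict_eq_self_of_ae_mem (mem_ae_iff.2 hκ)]
  exact hF.integrableOn_compact isCompact_Icc

/-- A finite measure on `[0, π]` is determined by its cosine moments. -/
theorem ext_of_integral_cos_eq {κ₁ κ₂ : Measure ℝ} [IsFiniteMeasure κ₁] [IsFiniteMeasure κ₂]
    (h₁ : κ₁ (Icc 0 Real.pi)ᶜ = 0) (h₂ : κ₂ (Icc 0 Real.pi)ᶜ = 0)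
    (h : ∀ n : ℕ, ∫ x, Real.cos (n * x) ∂κ₁ = ∫ x, Real.cos (n * x) ∂κ₂) : κ₁ = κ₂ := by
  have hcont : ∀ p : Polynomial ℝ, Continuous fun x : ℝ => p.eval (Real.cos x) := fun p =>
    p.continuous.comp Real.continuous_cos
  have hint₁ : ∀ p : Polynomial ℝ, Integrable (fun x : ℝ => p.eval (Real.cos x)) κ₁ := fun p =>
    integrable_of_continuous_of_measure_compl_Icc h₁ (hcont p).continuousOn
  have hint₂ : ∀ p : Polynomial ℝ, Integrable (fun x : ℝ => p.eval (Real.cos x)) κ₂ := fun p =>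
    integrable_of_continuous_of_measure_compl_Icc h₂ (hcont p).continuousOn
  have hpoly : ∀ p : Polynomial ℝ,
      ∫ x, p.eval (Real.cos x) ∂κ₁ = ∫ x, p.eval (Real.cos x) ∂κ₂ := by
    intro p
    have hp : p ∈ Submodule.span ℝ (range fun n : ℕ => Polynomial.Chebyshev.T ℝ n) := by
      rw [span_chebyshev_T_eq_top]; trivial
    induction hp using Submodule.span_induction with
    | mem p hp =>
      obtain ⟨n, rfl⟩ := hp
      simpa using h n
    | zero => simp
    | add p q _ _ hp hq =>
      simp only [Polynomial.eval_add]
      rw [integral_add (hint₁ p) (hint₁ q), integral_add (hint₂ p) (hint₂ q), hp, hq]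
    | smul c p _ hp =>
      simp only [Polynomial.eval_smul, smul_eq_mul, integral_const_mul, hp]
  have hae₁ : ∀ᵐ x ∂κ₁, x ∈ Icc 0 Real.pi := mem_ae_iff.2 h₁
  have hae₂ : ∀ᵐ x ∂κ₂, x ∈ Icc 0 Real.pi := mem_ae_iff.2 h₂
  refine ext_of_forall_integral_eq_of_IsFiniteMeasure fun F => ?_
  -- Weierstrass approximation of `F ∘ arccos` on `[-1, 1]`.
  refine eq_of_abs_sub_le_all fun ε hε => ?_
  set A := κ₁.real univ + κ₂.real univ + 1 with hA
  have hApos : 0 < A := by positivity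
  have hG : ContinuousOn (fun t => F (Real.arccos t)) (Icc (-1) 1) :=
    (F.continuous.comp Real.continuous_arccos).continuousOn
  obtain ⟨p, hp⟩ := exists_polynomial_near_of_continuousOn (-1) 1 _ hG (ε / A) (by positivity)
  have hnear : ∀ x ∈ Icc 0 Real.pi, ‖F x - p.eval (Real.cos x)‖ ≤ ε / A := by
    intro x hx
    have := hp (Real.cos x) ⟨Real.neg_one_le_cos x, Real.cos_le_one x⟩
    rw [Real.arccos_cos hx.1 hx.2, abs_sub_comm] at this
    exact this.le
  have e₁ : |∫ x, F x ∂κ₁ - ∫ x, p.eval (Real.cos x) ∂κ₁| ≤ ε / A * κ₁.real univ := by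
    rw [← integral_sub (F.integrable κ₁) (hint₁ p)]
    exact norm_integral_le_of_norm_le_const (hae₁.mono hnear)
  have e₂ : |∫ x, F x ∂κ₂ - ∫ x, p.eval (Real.cos x) ∂κ₂| ≤ ε / A * κ₂.real univ := by
    rw [← integral_sub (F.integrable κ₂) (hint₂ p)]
    exact norm_integral_le_of_norm_le_const (hae₂.mono hnear)
  rw [hpoly p] at e₁
  have e₃ : ε / A * κ₁.real univ + ε / A * κ₂.real univ ≤ ε := by
    rw [← mul_add, div_mul_eq_mul_div, div_le_iff₀ hApos]
    exact mul_le_mul_of_nonneg_left (by linarith) hε.le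
  rw [abs_le] at e₁ e₂ ⊢
  constructor <;> linarith [e₁.1, e₁.2, e₂.1, e₂.2]

/-- If a positive measure plus the negative part of a signed density equals the positive part of
that density, then the density has no negative part. -/
theorem eq_withDensity_of_add_withDensity_neg {κ μ : Measure ℝ} {h : ℝ → ℝ} (hm : Measurable h)
    (hκ : κ + μ.withDensity (fun x => ENNReal.ofReal (-h x)) =
      μ.withDensity fun x => ENNReal.ofReal (h x)) :
    κ = μ.withDensity (fun x => ENNReal.ofReal (h x)) ∧ ∀ᵐ x ∂μ, 0 ≤ h x := by
  have hS : MeasurableSet {x | h x < 0} := measurableSet_lt hm measurable_const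
  have h0 : (μ.withDensity fun x => ENNReal.ofReal (h x)) {x | h x < 0} = 0 := by
    rw [withDensity_apply _ hS, setLIntegral_congr_fun (g := fun _ => 0) hS]
    · simp
    · intro x hx
      exact ENNReal.ofReal_of_nonpos (le_of_lt hx)
  have h1 : (μ.withDensity fun x => ENNReal.ofReal (-h x)) {x | h x < 0} = 0 := by
    rw [← hκ, Measure.add_apply] at h0
    exact (add_eq_zero.1 h0).2
  have h2 : (fun x => ENNReal.ofReal (-h x)) =ᵐ[μ] 0 := by
    rw [withDensity_apply _ hS, lintegral_eq_zero_iff (by fun_prop)] at h1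
    have h3 := (ae_restrict_iff' hS).1 h1
    filter_upwards [h3] with x hx
    by_cases hneg : h x < 0
    · exact hx hneg
    · exact ENNReal.ofReal_of_nonpos (by linarith)
  refine ⟨?_, ?_⟩
  · rw [withDensity_congr_ae h2] at hκ
    simpa using hκ
  · filter_upwards [h2] with x hx
    simpa using hx

/-! ### Cosine series -/

theorem integral_cos_mul_cos (k n : ℕ) :
    ∫ x in (0 : ℝ)..Real.pi, Real.cos (k * x) * Real.cos ((n + 1 : ℕ) * x) =
      if k = n + 1 then Real.pi / 2 else 0 := by
  have h1 : ∀ x : ℝ, Real.cos (k * x) * Real.cos ((n + 1 : ℕ) * x) =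
      1 / 2 * (Real.cos ((k + (n + 1) : ℕ) * x) + Real.cos (((k : ℤ) - (n + 1) : ℤ) * x)) := by
    intro x
    push_cast
    rw [show ((k : ℝ) + (n + 1)) * x = k * x + (n + 1) * x by ring,
      show ((k : ℝ) - (n + 1)) * x = k * x - (n + 1) * x by ring, Real.cos_add, Real.cos_sub]
    ring
  have hdiff : ∫ x in (0 : ℝ)..Real.pi, Real.cos (((k : ℤ) - (n + 1) : ℤ) * x) =
      if k = n + 1 then Real.pi else 0 := by
    split_ifs with h
    · subst h; simp
    · have hne : (((k : ℤ) - (n + 1) : ℤ) : ℝ) ≠ 0 := by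
        rw [Int.cast_ne_zero]; omega
      rw [intervalIntegral.integral_comp_mul_left (fun t => Real.cos t) hne]
      simp [-Int.cast_sub]
  simp_rw [h1]
  rw [intervalIntegral.integral_const_mul, intervalIntegral.integral_add
    (Continuous.intervalIntegrable (by fun_prop) _ _)
    (Continuous.intervalIntegrable (by fun_prop) _ _), integral_cos_nat_mul (by omega), hdiff]
  split_ifs <;> ring

/-- The cosine series `(1 / π) (1 + 2 ∑_{n ≥ 1} b n cos (n x))`, the formal density on `[0, π]` of a
unit measure with cosine moments `b n`. -/
def cosSeries (b : ℕ → ℝ) (x : ℝ) : ℝ :=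
  1 / Real.pi * (1 + 2 * ∑' n : ℕ, b (n + 1) * Real.cos ((n + 1 : ℕ) * x))

theorem norm_mul_cos_le (c t : ℝ) : ‖c * Real.cos t‖ ≤ ‖c‖ := by
  rw [norm_mul]
  exact mul_le_of_le_one_right (norm_nonneg _) (Real.abs_cos_le_one _)

theorem summable_mul_cos {b : ℕ → ℝ} (hb : Summable fun n => ‖b (n + 1)‖) (x : ℝ) :
    Summable fun n : ℕ => b (n + 1) * Real.cos ((n + 1 : ℕ) * x) :=
  Summable.of_norm_bounded hb fun _ => norm_mul_cos_le _ _

theorem continuous_cosSeries {b : ℕ → ℝ} (hb : Summable fun n => ‖b (n + 1)‖) :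
    Continuous (cosSeries b) :=
  continuous_const.mul (continuous_const.add (continuous_const.mul
    (continuous_tsum (fun n => by fun_prop) hb fun n x => norm_mul_cos_le _ _)))

theorem integral_cos_mul_cosSeries {b : ℕ → ℝ} (hb : Summable fun n => ‖b (n + 1)‖)
    (hb0 : b 0 = 1) (k : ℕ) :
    ∫ x in (0 : ℝ)..Real.pi, Real.cos (k * x) * cosSeries b x = b k := by
  have hsum : HasSum (fun n : ℕ => ∫ x in (0 : ℝ)..Real.pi,
      Real.cos (k * x) * (b (n + 1) * Real.cos ((n + 1 : ℕ) * x)))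
      (∫ x in (0 : ℝ)..Real.pi, Real.cos (k * x) *
        ∑' n : ℕ, b (n + 1) * Real.cos ((n + 1 : ℕ) * x)) := by
    refine intervalIntegral.hasSum_integral_of_dominated_convergence (fun n _ => ‖b (n + 1)‖)
      (fun n => (by fun_prop : Measurable _).aestronglyMeasurable) ?_ ?_
      intervalIntegrable_const ?_
    · intro n
      refine Eventually.of_forall fun x _ => ?_
      rw [mul_comm]
      exact (norm_mul_cos_le _ _).trans (norm_mul_cos_le _ _)
    · exact Eventually.of_forall fun x _ => hb
    · exact Eventually.of_forall fun x _ => (summable_mul_cos hb x).hasSum.mul_left _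
  have hterm : ∀ n : ℕ, ∫ x in (0 : ℝ)..Real.pi,
      Real.cos (k * x) * (b (n + 1) * Real.cos ((n + 1 : ℕ) * x)) =
      if k = n + 1 then b k * (Real.pi / 2) else 0 := by
    intro n
    simp_rw [mul_left_comm _ (b (n + 1)), intervalIntegral.integral_const_mul,
      integral_cos_mul_cos]
    split_ifs with h
    · rw [h]
    · rw [mul_zero]
  simp_rw [hterm] at hsum
  have hval : ∫ x in (0 : ℝ)..Real.pi, Real.cos (k * x) *
      ∑' n : ℕ, b (n + 1) * Real.cos ((n + 1 : ℕ) * x) =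
      if k = 0 then 0 else b k * (Real.pi / 2) := by
    rw [← hsum.tsum_eq]
    rcases k with _ | k
    · simp
    · rw [tsum_eq_single k]
      · simp
      · intro n hn
        rw [if_neg (by omega)]
  have hc : ∫ x in (0 : ℝ)..Real.pi, Real.cos (k * x) = if k = 0 then Real.pi else 0 := by
    split_ifs with h
    · simp [h]
    · exact integral_cos_nat_mul h
  have hcont : Continuous fun x : ℝ => ∑' n : ℕ, b (n + 1) * Real.cos ((n + 1 : ℕ) * x) :=
    continuous_tsum (fun n => by fun_prop) hb fun n x => norm_mul_cos_le _ _
  have hsplit : ∀ x : ℝ, Real.cos (k * x) * cosSeries b x = 1 / Real.pi * (Real.cos (k * x) +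
      2 * (Real.cos (k * x) * ∑' n : ℕ, b (n + 1) * Real.cos ((n + 1 : ℕ) * x))) := by
    intro x; rw [cosSeries]; ring
  simp_rw [hsplit]
  rw [intervalIntegral.integral_const_mul, intervalIntegral.integral_add
    (Continuous.intervalIntegrable (by fun_prop) _ _)
    (Continuous.intervalIntegrable (by fun_prop) _ _), intervalIntegral.integral_const_mul, hval,
    hc]
  have hpi := Real.pi_ne_zero
  split_ifs with h
  · rw [h, hb0]; field_simp; ring
  · field_simp; ring

/-- A unit measure on `[0, π]` with summable cosine moments has its cosine series as a continuous
non-negative density. The sign of the series is not known beforehand, so the positive measures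
`κ + h⁻ dx` and `h⁺ dx` are compared. -/
theorem eq_withDensity_cosSeries {κ : Measure ℝ} [IsProbabilityMeasure κ]
    (hκ : κ (Icc 0 Real.pi)ᶜ = 0) {b : ℕ → ℝ} (hb : Summable fun n => ‖b (n + 1)‖)
    (hmom : ∀ n : ℕ, ∫ x, Real.cos (n * x) ∂κ = b n) :
    κ = (volume.restrict (Ioo 0 Real.pi)).withDensity (fun x => ENNReal.ofReal (cosSeries b x)) ∧
    ∀ x ∈ Icc 0 Real.pi, 0 ≤ cosSeries b x := by
  set μ : Measure ℝ := volume.restrict (Ioo 0 Real.pi) with hμ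
  have hμ' : μ = volume.restrict (Ioc 0 Real.pi) := restrict_Ioo_eq_restrict_Ioc
  set h := cosSeries b with hh
  have hcont : Continuous h := continuous_cosSeries hb
  have hint : Integrable h μ :=
    (hcont.integrableOn_Icc (a := 0) (b := Real.pi)).mono_set Ioo_subset_Icc_self
  have hb0 : b 0 = 1 := by rw [← hmom 0]; simp
  have hcont' : Continuous fun x => -h x := hcont.neg
  have fin1 : IsFiniteMeasure (μ.withDensity fun x => ENNReal.ofReal (h x)) :=
    isFiniteMeasure_withDensity_ofReal hint.2
  have fin2 : IsFiniteMeasure (μ.withDensity fun x => ENNReal.ofReal (-h x)) :=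
    isFiniteMeasure_withDensity_ofReal hint.neg.2
  have hnull : ∀ g : ℝ → ENNReal, (μ.withDensity g) (Icc 0 Real.pi)ᶜ = 0 := by
    intro g
    refine withDensity_absolutelyContinuous μ g ?_
    rw [hμ, Measure.restrict_apply measurableSet_Icc.compl]
    have : (Icc 0 Real.pi)ᶜ ∩ Ioo 0 Real.pi = ∅ := by
      ext x; simp only [mem_inter_iff, mem_compl_iff, mem_empty_iff_false, iff_false]
      exact fun hx => hx.1 (Ioo_subset_Icc_self hx.2)
    rw [this]; simp
  have hwd : ∀ (g : ℝ → ℝ) (n : ℕ), Continuous g →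
      ∫ x, Real.cos (n * x) ∂(μ.withDensity fun x => ENNReal.ofReal (g x)) =
      ∫ x, max (g x) 0 * Real.cos (n * x) ∂μ := by
    intro g n hg
    rw [integral_withDensity_eq_integral_toReal_smul (by fun_prop) (by simp)]
    rfl
  have hintg : ∀ (g : ℝ → ℝ) (n : ℕ), Continuous g →
      Integrable (fun x => max (g x) 0 * Real.cos (n * x)) μ := fun g n hg =>
    ((by fun_prop : Continuous fun x => max (g x) 0 * Real.cos (n * x)).integrableOn_Icc
      (a := 0) (b := Real.pi)).mono_set Ioo_subset_Icc_self
  have hsum : κ + μ.withDensity (fun x => ENNReal.ofReal (-h x)) =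
      μ.withDensity fun x => ENNReal.ofReal (h x) := by
    refine ext_of_integral_cos_eq ?_ (hnull _) fun n => ?_
    · rw [Measure.add_apply, hκ, hnull, add_zero]
    · rw [integral_add_measure, hmom, hwd _ n hcont', hwd _ n hcont,
        ← integral_cos_mul_cosSeries hb hb0 n, ← hh,
        intervalIntegral.integral_of_le Real.pi_pos.le, ← hμ',
        ← integral_add _ (hintg _ n hcont')]
      · refine integral_congr_ae (Eventually.of_forall fun x => ?_)
        simp only
        rcases le_total (h x) 0 with hx | hx
        · rw [max_eq_right hx, max_eq_left (by linarith)]; ring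
        · rw [max_eq_left hx, max_eq_right (by linarith)]; ring
      · exact ((by fun_prop : Continuous fun x => Real.cos (n * x) * h x).integrableOn_Icc
          (a := 0) (b := Real.pi)).mono_set Ioo_subset_Icc_self
      · exact integrable_of_continuous_of_measure_compl_Icc hκ (by fun_prop)
      · exact integrable_of_continuous_of_measure_compl_Icc (hnull _) (by fun_prop)
  obtain ⟨h1, h2⟩ := eq_withDensity_of_add_withDensity_neg hcont.measurable hsum
  refine ⟨h1, ?_⟩
  have h3 : ∀ x ∈ Ioo 0 Real.pi, 0 ≤ h x := by
    by_contra! hcon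
    obtain ⟨x, hx, hneg⟩ := hcon
    have hopen : IsOpen ({x | h x < 0} ∩ Ioo 0 Real.pi) :=
      (isOpen_lt hcont continuous_const).inter isOpen_Ioo
    have hpos := hopen.measure_pos volume ⟨x, hneg, hx⟩
    have h4 := (ae_restrict_iff' measurableSet_Ioo).1 h2
    have : volume ({x | h x < 0} ∩ Ioo 0 Real.pi) = 0 := by
      refine measure_mono_null ?_ (ae_iff.1 h4)
      rintro y ⟨hy, hy'⟩
      simp only [mem_ofPred_eq, Classical.not_imp, not_le]
      exact ⟨hy', hy⟩
    exact hpos.ne' this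
  have hclosed : IsClosed {x | 0 ≤ h x} := isClosed_le continuous_const hcont
  intro x hx
  rw [← closure_Ioo Real.pi_pos.ne] at hx
  exact hclosed.closure_subset_iff.2 h3 hx

/-! ### Partial sums of the conjugate series -/

/-- The Riemann–Lebesgue lemma for cosine coefficients. -/
theorem tendsto_integral_mul_cos {f : ℝ → ℝ} {a b : ℝ} (hab : a ≤ b)
    (hf : IntervalIntegrable f volume a b) :
    Tendsto (fun n : ℕ => ∫ x in a..b, f x * Real.cos (n * x)) atTop (𝓝 0) := by
  have hw : Tendsto (fun n : ℕ => (n : ℝ) / (2 * Real.pi)) atTop (cocompact ℝ) :=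
    (tendsto_natCast_atTop_atTop.atTop_div_const Real.two_pi_pos).mono_right
      atTop_le_cocompact
  have hf' : Integrable ((Ioc a b).indicator fun x => (f x : ℂ)) :=
    (integrable_indicator_iff measurableSet_Ioc).2
      ((intervalIntegrable_iff_integrableOn_Ioc_of_le hab).1 hf).ofReal
  have h1 := (Complex.continuous_re.tendsto _).comp
    ((Real.tendsto_integral_exp_smul_cocompact
      ((Ioc a b).indicator fun x => (f x : ℂ))).comp hw)
  simp only [Complex.zero_re] at h1
  refine h1.congr fun n => ?_
  simp only [Function.comp]
  have hi : Integrable fun v : ℝ => Real.fourierChar (-(v * ((n : ℝ) / (2 * Real.pi)))) •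
      (Ioc a b).indicator (fun x => (f x : ℂ)) v := by
    simp only [Circle.smul_def]
    refine hf'.bdd_mul (c := 1) (Continuous.aestronglyMeasurable ?_)
      (Eventually.of_forall fun v => (Circle.norm_coe _).le)
    exact continuous_subtype_val.comp (Real.continuous_fourierChar.comp (by fun_prop))
  rw [intervalIntegral.integral_of_le hab, ← integral_indicator measurableSet_Ioc]
  have := (integral_re hi).symm
  simp only [RCLike.re_to_complex] at this
  rw [this]
  refine integral_congr_ae (Eventually.of_forall fun x => ?_)
  by_cases hx : x ∈ Ioc a b
  · simp only [indicator_of_mem hx, Circle.smul_def, Real.fourierChar_apply, smul_eq_mul,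
      Complex.mul_re, Complex.ofReal_re, Complex.ofReal_im, mul_zero, sub_zero]
    rw [Complex.exp_ofReal_mul_I_re, mul_comm]
    congr 1
    rw [← Real.cos_neg]
    congr 1
    field_simp
  · simp [indicator_of_notMem hx]

/-- If `q (cos ψ - cos φ) = R - R φ`, then the partial sums of `∑ r_n sin (n φ)`, with `r_n` the
cosine transform of `R`, equal `sin φ / 2` times the integral of `q` up to boundary terms: the cosine
transforms of `q` satisfy a three-term recursion, so that the sums telescope. -/
theorem sum_cosTransform_mul_sin {R q : ℝ → ℝ} {φ : ℝ}
    (hq : IntervalIntegrable q volume 0 Real.pi)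
    (hqR : ∀ᵐ x ∂volume, x ∈ Ioc 0 Real.pi → q x * (Real.cos x - Real.cos φ) = R x - R φ)
    (N : ℕ) :
    ∑ n ∈ Finset.range N, (∫ x in (0 : ℝ)..Real.pi, R x * Real.cos ((n + 1 : ℕ) * x)) *
      Real.sin ((n + 1 : ℕ) * φ) =
    1 / 2 * (Real.sin φ * (∫ x in (0 : ℝ)..Real.pi, q x) +
      Real.sin (N * φ) * (∫ x in (0 : ℝ)..Real.pi, q x * Real.cos ((N + 1 : ℕ) * x)) -
      Real.sin ((N + 1 : ℕ) * φ) * (∫ x in (0 : ℝ)..Real.pi, q x * Real.cos (N * x))) := by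
  have hqc : ∀ n : ℕ, IntervalIntegrable (fun x => q x * Real.cos (n * x)) volume 0 Real.pi :=
    fun n => hq.mul_continuousOn (by fun_prop)
  have hrec : ∀ n : ℕ, ∫ x in (0 : ℝ)..Real.pi, R x * Real.cos ((n + 1 : ℕ) * x) =
      1 / 2 * ((∫ x in (0 : ℝ)..Real.pi, q x * Real.cos ((n + 2 : ℕ) * x)) +
        ∫ x in (0 : ℝ)..Real.pi, q x * Real.cos (n * x)) -
      Real.cos φ * ∫ x in (0 : ℝ)..Real.pi, q x * Real.cos ((n + 1 : ℕ) * x) := by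
    intro n
    have hconst : ∫ x in (0 : ℝ)..Real.pi, R φ * Real.cos ((n + 1 : ℕ) * x) = 0 := by
      rw [intervalIntegral.integral_const_mul, integral_cos_nat_mul (by omega), mul_zero]
    rw [← add_zero (∫ x in (0 : ℝ)..Real.pi, R x * _)]
    have hI : IntervalIntegrable (fun x => (1 / 2 * (q x * Real.cos ((n + 2 : ℕ) * x) +
        q x * Real.cos (n * x)) - Real.cos φ * (q x * Real.cos ((n + 1 : ℕ) * x)))) volume 0
        Real.pi := (((hqc _).add (hqc _)).const_mul _).sub ((hqc _).const_mul _)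
    have hR : ∫ x in (0 : ℝ)..Real.pi, R x * Real.cos ((n + 1 : ℕ) * x) =
        ∫ x in (0 : ℝ)..Real.pi, ((1 / 2 * (q x * Real.cos ((n + 2 : ℕ) * x) +
          q x * Real.cos (n * x)) - Real.cos φ * (q x * Real.cos ((n + 1 : ℕ) * x))) +
          R φ * Real.cos ((n + 1 : ℕ) * x)) := by
      refine intervalIntegral.integral_congr_ae ?_
      rw [uIoc_of_le Real.pi_pos.le]
      filter_upwards [hqR] with x hx hm
      have e1 : ((n + 2 : ℕ) : ℝ) * x = (n + 1 : ℕ) * x + x := by push_cast; ring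
      have e2 : (n : ℝ) * x = (n + 1 : ℕ) * x - x := by push_cast; ring
      rw [e1, e2, Real.cos_add, Real.cos_sub]
      linear_combination -Real.cos ((n + 1 : ℕ) * x) * hx hm
    rw [add_zero, hR, intervalIntegral.integral_add hI
      (Continuous.intervalIntegrable (by fun_prop) _ _), hconst, add_zero,
      intervalIntegral.integral_sub (((hqc _).add (hqc _)).const_mul _) ((hqc _).const_mul _),
      intervalIntegral.integral_const_mul, intervalIntegral.integral_const_mul,
      intervalIntegral.integral_add (hqc _) (hqc _)]
  induction N with
  | zero => simp
  | succ N ih =>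
    rw [Finset.sum_range_succ, ih, hrec]
    have e1 : ((N + 1 + 1 : ℕ) : ℝ) * φ = (N + 1 : ℕ) * φ + φ := by push_cast; ring
    have e2 : (N : ℝ) * φ = (N + 1 : ℕ) * φ - φ := by push_cast; ring
    rw [e1, e2, Real.sin_add, Real.sin_sub]
    ring

theorem tendsto_sum_cosTransform_mul_sin {R q : ℝ → ℝ} {φ : ℝ}
    (hq : IntervalIntegrable q volume 0 Real.pi)
    (hqR : ∀ᵐ x ∂volume, x ∈ Ioc 0 Real.pi → q x * (Real.cos x - Real.cos φ) = R x - R φ) :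
    Tendsto (fun N => ∑ n ∈ Finset.range N,
      (∫ x in (0 : ℝ)..Real.pi, R x * Real.cos ((n + 1 : ℕ) * x)) *
      Real.sin ((n + 1 : ℕ) * φ)) atTop
      (𝓝 (1 / 2 * (Real.sin φ * ∫ x in (0 : ℝ)..Real.pi, q x))) := by
  simp_rw [sum_cosTransform_mul_sin hq hqR]
  have hb : ∀ (u : ℕ → ℝ) (v : ℕ → ℝ), Tendsto v atTop (𝓝 0) →
      Tendsto (fun N : ℕ => Real.sin (u N) * v N) atTop (𝓝 0) := fun u v hv => by
    refine squeeze_zero_norm (fun N => ?_) (tendsto_norm_zero.comp hv)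
    rw [norm_mul]
    exact mul_le_of_le_one_left (norm_nonneg _) (Real.abs_sin_le_one _)
  have hRL := tendsto_integral_mul_cos Real.pi_pos.le hq
  have h1 := hb (fun N => N * φ) _ ((tendsto_add_atTop_iff_nat 1).2 hRL)
  have h2 := hb (fun N => (N + 1 : ℕ) * φ) _ hRL
  have h3 := (((tendsto_const_nhds (x := Real.sin φ * ∫ x in (0 : ℝ)..Real.pi, q x)).add h1).sub
    h2).const_mul (1 / 2)
  rwa [add_zero, sub_zero] at h3

/-- Partial sums of the cosine series whose coefficients are the sine transforms of
`2 R(x) sin x`. -/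
theorem sum_sub_mul_cos (r : ℕ → ℝ) (φ : ℝ) (N : ℕ) :
    ∑ n ∈ Finset.range N, (r n - r (n + 2)) * Real.cos ((n + 1 : ℕ) * φ) =
      r 0 * Real.cos φ + r 1 -
        2 * Real.sin φ * (∑ n ∈ Finset.range N, r (n + 1) * Real.sin ((n + 1 : ℕ) * φ)) -
        (r N * Real.cos ((N + 1 : ℕ) * φ) + r (N + 1) * Real.cos (N * φ)) := by
  induction N with
  | zero => simp
  | succ N ih =>
    rw [Finset.sum_range_succ, Finset.sum_range_succ, ih]
    have e1 : ((N + 1 + 1 : ℕ) : ℝ) * φ = (N + 1 : ℕ) * φ + φ := by push_cast; ring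
    have e2 : (N : ℝ) * φ = (N + 1 : ℕ) * φ - φ := by push_cast; ring
    rw [e1, e2, Real.cos_add, Real.cos_sub]
    ring

/-- If the coefficients of a cosine series are `-(a / 2π) (r_{n-1} - r_{n+1})`, with `r_n` the
cosine transform of `R`, and if the series vanishes at both ends of `[0, π]`, then it equals
`(a / π²) sin² φ ∫ (R ψ - R φ) / (cos ψ - cos φ) dψ`: the two end conditions amount to `r_0 = 0` and
`a r_1 = π`, which cancels the part of the sum without the factor `sin φ`. -/
theorem cosSeries_eq_of_eq_zero {R : ℝ → ℝ} (hR : IntervalIntegrable R volume 0 Real.pi)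
    {b : ℕ → ℝ} (hb : Summable fun n => ‖b (n + 1)‖) {a : ℝ}
    (hbR : ∀ n : ℕ, b (n + 1) = -(a / (2 * Real.pi)) *
      ((∫ x in (0 : ℝ)..Real.pi, R x * Real.cos (n * x)) -
        ∫ x in (0 : ℝ)..Real.pi, R x * Real.cos ((n + 2 : ℕ) * x)))
    (h0 : cosSeries b 0 = 0) (hpi : cosSeries b Real.pi = 0) {q : ℝ → ℝ} {φ : ℝ}
    (hq : IntervalIntegrable q volume 0 Real.pi)
    (hqR : ∀ᵐ x ∂volume, x ∈ Ioc 0 Real.pi → q x * (Real.cos x - Real.cos φ) = R x - R φ) :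
    cosSeries b φ = a / Real.pi ^ 2 * Real.sin φ ^ 2 * ∫ x in (0 : ℝ)..Real.pi, q x := by
  set r : ℕ → ℝ := fun n => ∫ x in (0 : ℝ)..Real.pi, R x * Real.cos (n * x) with hr
  have hrlim : Tendsto r atTop (𝓝 0) := tendsto_integral_mul_cos Real.pi_pos.le hR
  have hcos : ∀ (u : ℕ → ℝ) (v : ℕ → ℝ), Tendsto v atTop (𝓝 0) →
      Tendsto (fun N : ℕ => v N * Real.cos (u N)) atTop (𝓝 0) := fun u v hv =>
    squeeze_zero_norm (fun N => norm_mul_cos_le _ _) (tendsto_norm_zero.comp hv)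
  have hval : ∀ (t s : ℝ), Tendsto (fun N => ∑ n ∈ Finset.range N,
      r (n + 1) * Real.sin ((n + 1 : ℕ) * t)) atTop (𝓝 s) →
      cosSeries b t = 1 / Real.pi * (1 - a / Real.pi *
        (r 0 * Real.cos t + r 1 - 2 * Real.sin t * s)) := by
    intro t s hs
    have h1 := (summable_mul_cos hb t).hasSum.tendsto_sum_nat
    have h2 : Tendsto (fun N => ∑ n ∈ Finset.range N, (r n - r (n + 2)) *
        Real.cos ((n + 1 : ℕ) * t)) atTop (𝓝 (r 0 * Real.cos t + r 1 - 2 * Real.sin t * s)) := by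
      simp_rw [sum_sub_mul_cos]
      simpa using (((tendsto_const_nhds (x := r 0 * Real.cos t + r 1)).sub
        (hs.const_mul (2 * Real.sin t))).sub
        ((hcos (fun N => (N + 1 : ℕ) * t) _ hrlim).add
          (hcos (fun N => N * t) _ ((tendsto_add_atTop_iff_nat 1).2 hrlim))))
    have h3 : (fun N => ∑ n ∈ Finset.range N, b (n + 1) * Real.cos ((n + 1 : ℕ) * t)) =
        fun N => -(a / (2 * Real.pi)) * ∑ n ∈ Finset.range N, (r n - r (n + 2)) *
          Real.cos ((n + 1 : ℕ) * t) := by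
      funext N
      rw [Finset.mul_sum]
      refine Finset.sum_congr rfl fun n _ => ?_
      rw [hbR]; ring
    rw [h3] at h1
    rw [cosSeries, tendsto_nhds_unique h1 (h2.const_mul _)]
    field_simp
    ring
  have e0 := hval 0 0 (by simp)
  have epi := hval Real.pi 0 (by simp [Real.sin_nat_mul_pi, -Nat.cast_add])
  have e := hval φ _ (tendsto_sum_cosTransform_mul_sin hq hqR)
  rw [h0] at e0
  rw [hpi] at epi
  have hπ := Real.pi_ne_zero
  simp only [Real.cos_zero, Real.sin_zero, Real.cos_pi, Real.sin_pi] at e0 epi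
  field_simp at e0 epi
  have hr0 : a * r 0 = 0 := by linarith
  have hr1 : a * r 1 = Real.pi := by linarith
  rw [e]
  field_simp
  linear_combination -hr1 - Real.cos φ * hr0

/-! ### The logarithmic potential on the support -/

theorem chord_eq (x y : ℝ) : chord x y = 2 * |Real.sin ((x - y) / 2)| := by
  have h : chord x y ^ 2 = (2 * |Real.sin ((x - y) / 2)|) ^ 2 := by
    rw [mul_pow, sq_abs, chord, ← Complex.normSq_eq_norm_sq, Complex.normSq_apply,
      mul_comm Complex.I, mul_comm Complex.I]
    simp only [Complex.sub_re, Complex.sub_im, Complex.exp_ofReal_mul_I_re,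
      Complex.exp_ofReal_mul_I_im]
    have hc : Real.cos (x - y) = 1 - 2 * Real.sin ((x - y) / 2) ^ 2 := by
      rw [Real.sin_sq, ← mul_div_cancel₀ (x - y) (two_ne_zero' ℝ), Real.cos_two_mul]
      ring_nf
    rw [Real.cos_sub] at hc
    linear_combination Real.sin_sq_add_cos_sq x + Real.sin_sq_add_cos_sq y - 2 * hc
  exact (pow_left_inj₀ (norm_nonneg _) (by positivity) two_ne_zero).1 h

theorem chord_nonneg (x y : ℝ) : 0 ≤ chord x y := norm_nonneg _

theorem chord_le_two (x y : ℝ) : chord x y ≤ 2 := by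
  rw [chord_eq]
  linarith [Real.abs_sin_le_one ((x - y) / 2)]

theorem measurable_chord (x : ℝ) : Measurable (chord x) := by
  have : chord x = fun y => 2 * |Real.sin ((x - y) / 2)| := funext fun y => chord_eq x y
  rw [this]; fun_prop

/-- The measure `m` does not charge `x` and has at `x ∈ [-θ, θ]` the finite logarithmic potential
`g x`, the integral being absolutely convergent. -/
def HasLogPotentialOn (m : Measure ℝ) (θ : ℝ) (g : ℝ → ℝ) : Prop :=
  ∀ x ∈ Icc (-θ) θ, (∀ᵐ y ∂m, chord x y ≠ 0) ∧ Integrable (fun y => Real.log (chord x y)) m ∧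
    ∫ y, Real.log (chord x y) ∂m = g x

theorem log_chord_of_lintegral_ne_top {m : Measure ℝ} [IsProbabilityMeasure m] {x : ℝ}
    (h : ∫⁻ y, logKernel x y ∂m ≠ ⊤) :
    (∀ᵐ y ∂m, chord x y ≠ 0) ∧ Integrable (fun y => Real.log (chord x y)) m ∧
      ∫ y, Real.log (chord x y) ∂m = Real.log 2 - (∫⁻ y, logKernel x y ∂m).toReal := by
  have hmeas : Measurable (logKernel x) := by
    unfold logKernel
    have := measurable_chord x
    exact Measurable.ite (this (measurableSet_singleton 0)) measurable_const (by fun_prop)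
  have h1 : ∀ᵐ y ∂m, chord x y ≠ 0 := by
    filter_upwards [ae_lt_top hmeas h] with y hy h0
    simp [logKernel, h0] at hy
  have hnn : ∀ y, 0 ≤ Real.log (2 / chord x y) := by
    intro y
    rcases (chord_nonneg x y).eq_or_lt with h0 | h0
    · rw [← h0]; simp
    · exact Real.log_nonneg ((one_le_div h0).2 (chord_le_two x y))
  have hK : (fun y => logKernel x y) =ᵐ[m] fun y => ENNReal.ofReal (Real.log (2 / chord x y)) := by
    filter_upwards [h1] with y hy
    simp [logKernel, hy]
  have hlm : Measurable fun y => Real.log (2 / chord x y) := by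
    have := measurable_chord x
    fun_prop
  rw [lintegral_congr_ae hK] at h ⊢
  have hint : Integrable (fun y => Real.log (2 / chord x y)) m := by
    refine ⟨hlm.aestronglyMeasurable, ?_⟩
    rw [hasFiniteIntegral_iff_ofReal (Eventually.of_forall hnn)]
    exact h.lt_top
  have hlog : (fun y => Real.log (chord x y)) =ᵐ[m]
      fun y => Real.log 2 - Real.log (2 / chord x y) := by
    filter_upwards [h1] with y hy
    rw [Real.log_div two_ne_zero hy]; ring
  refine ⟨h1, ((integrable_const _).sub hint).congr hlog.symm, ?_⟩
  rw [integral_congr_ae hlog, integral_sub (integrable_const _) hint,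
    integral_eq_lintegral_of_nonneg_ae (Eventually.of_forall hnn) hlm.aestronglyMeasurable]
  simp

/-- The effective potential is constant and finite on the set where it is minimal, so that the
logarithmic potential of the equilibrium measure is explicit there, up to an additive constant. -/
theorem exists_hasLogPotentialOn {V : ℝ → ℝ} {m : Measure ℝ} [IsProbabilityMeasure m] {θ : ℝ}
    (hθ : 0 < θ) (hθπ : θ < Real.pi)
    (hmin : ∀ x ∈ Icc (-Real.pi) Real.pi,
      (IsMinOn (effectivePotential V m) (Icc (-Real.pi) Real.pi) x ↔ x ∈ Icc (-θ) θ)) :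
    ∃ ℓ : ℝ, HasLogPotentialOn m θ fun x => (V (Real.cos x) - ℓ) / 2 := by
  have hsub : Icc (-θ) θ ⊆ Icc (-Real.pi) Real.pi := Icc_subset_Icc (by linarith) hθπ.le
  have h0 : (0 : ℝ) ∈ Icc (-θ) θ := ⟨by linarith, hθ.le⟩
  have hconst : ∀ x ∈ Icc (-θ) θ, effectivePotential V m x = effectivePotential V m 0 :=
    fun x hx => le_antisymm ((hmin x (hsub hx)).2 hx (hsub h0))
      ((hmin 0 (hsub h0)).2 h0 (hsub hx))
  have hval : ∀ x, (hfin : ∫⁻ y, logKernel x y ∂m ≠ ⊤) → effectivePotential V m x =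
      ((V (Real.cos x) + 2 * ((∫⁻ y, logKernel x y ∂m).toReal - Real.log 2) : ℝ) : EReal) := by
    intro x hfin
    rw [effectivePotential, logPotential, ← EReal.coe_ennreal_toReal hfin]
    push_cast
    rfl
  have htop : ∀ x, ∫⁻ y, logKernel x y ∂m = ⊤ → effectivePotential V m x = ⊤ := by
    intro x hfin
    rw [effectivePotential, logPotential, hfin]
    have : ((2 : EReal)) = ((2 : ℝ) : EReal) := rfl
    rw [EReal.coe_ennreal_top, EReal.top_sub_coe, this, EReal.coe_mul_top_of_pos two_pos,
      EReal.coe_add_top]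
  -- If the minimum were `+∞`, every point of `[-π, π]` would be a minimizer.
  have hne : effectivePotential V m 0 ≠ ⊤ := by
    intro h
    have hpi : Real.pi ∈ Icc (-Real.pi) Real.pi := ⟨by linarith [Real.pi_pos], le_rfl⟩
    have hall : IsMinOn (effectivePotential V m) (Icc (-Real.pi) Real.pi) Real.pi := by
      intro y hy
      have := (hmin 0 (hsub h0)).2 h0 hy
      simp only [mem_ofPred_eq] at this ⊢
      rw [h, top_le_iff] at this
      rw [this]; exact le_top
    exact absurd ((hmin Real.pi hpi).1 hall).2 (not_le.2 hθπ)
  have hfin : ∀ x ∈ Icc (-θ) θ, ∫⁻ y, logKernel x y ∂m ≠ ⊤ := fun x hx h =>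
    hne ((hconst x hx).symm.trans (htop x h))
  refine ⟨V (Real.cos 0) + 2 * ((∫⁻ y, logKernel 0 y ∂m).toReal - Real.log 2), fun x hx => ?_⟩
  obtain ⟨h1, h2, h3⟩ := log_chord_of_lintegral_ne_top (hfin x hx)
  refine ⟨h1, h2, ?_⟩
  have h4 := hconst x hx
  rw [hval x (hfin x hx), hval 0 (hfin 0 h0), EReal.coe_eq_coe_iff] at h4
  rw [h3, ← h4]; ring

theorem HasLogPotentialOn.map_neg {m : Measure ℝ} {θ : ℝ} {g : ℝ → ℝ}
    (h : HasLogPotentialOn m θ g) (hg : ∀ x, g (-x) = g x) :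
    HasLogPotentialOn (m.map fun x => -x) θ g := by
  have hch : ∀ x y, chord x (-y) = chord (-x) y := fun x y => by
    rw [chord_eq, chord_eq, ← abs_neg, ← Real.sin_neg]; congr 3; ring
  have hneg : MeasurableEmbedding fun x : ℝ => -x := measurableEmbedding_neg
  intro x hx
  obtain ⟨h1, h2, h3⟩ := h (-x) ⟨by linarith [hx.2], by linarith [hx.1]⟩
  simp_rw [← hch] at h1 h2 h3
  refine ⟨hneg.ae_map_iff.2 h1, hneg.integrable_map_iff.2 h2, ?_⟩
  rw [hneg.integral_map, h3, hg]

theorem cos_half_pos_of_mem {θ x : ℝ} (hθπ : θ < Real.pi) (hx : x ∈ Icc (-θ) θ) :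
    0 < Real.cos (x / 2) :=
  Real.cos_pos_of_mem_Ioo ⟨by linarith [hx.1], by linarith [hx.2]⟩

theorem tan_half_sub_tan_half {x y : ℝ} (hx : Real.cos (x / 2) ≠ 0) (hy : Real.cos (y / 2) ≠ 0) :
    Real.tan (x / 2) - Real.tan (y / 2) =
      Real.sin ((x - y) / 2) / (Real.cos (x / 2) * Real.cos (y / 2)) := by
  rw [Real.tan_eq_sin_div_cos, Real.tan_eq_sin_div_cos, sub_div, Real.sin_sub]
  field_simp

theorem measurable_arccos_tan_half (θ : ℝ) :
    Measurable fun y : ℝ => Real.arccos (Real.tan (y / 2) / Real.tan (θ / 2)) := by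
  have : Measurable Real.tan := by
    rw [show Real.tan = fun x => Real.sin x / Real.cos x from funext Real.tan_eq_sin_div_cos]
    fun_prop
  exact Real.continuous_arccos.measurable.comp (by fun_prop)

theorem cos_arccos_tan_half {θ y : ℝ} (hθ : 0 < θ) (hθπ : θ < Real.pi) (hy : y ∈ Icc (-θ) θ) :
    Real.cos (Real.arccos (Real.tan (y / 2) / Real.tan (θ / 2))) =
      Real.tan (y / 2) / Real.tan (θ / 2) := by
  have hTpos : 0 < Real.tan (θ / 2) :=
    Real.tan_pos_of_pos_of_lt_pi_div_two (by linarith) (by linarith)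
  have hmono : ∀ u v : ℝ, -(Real.pi / 2) < u → u ≤ v → v < Real.pi / 2 →
      Real.tan u ≤ Real.tan v := fun u v h1 h2 h3 =>
    Real.strictMonoOn_tan.monotoneOn ⟨h1, h2.trans_lt h3⟩ ⟨h1.trans_le h2, h3⟩ h2
  have h1 := hmono (y / 2) (θ / 2) (by linarith [hy.1]) (by linarith [hy.2]) (by linarith)
  have h2 := hmono (-(θ / 2)) (y / 2) (by linarith) (by linarith [hy.1]) (by linarith [hy.2])
  rw [Real.tan_neg] at h2
  refine Real.cos_arccos ?_ ?_
  · rw [le_div_iff₀ hTpos]; linarith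
  · rw [div_le_one hTpos]; exact h1

/-- In the coordinate `tan (x / 2) = T cos φ`, a unit measure on the arc `[-θ, θ]` becomes a unit
measure on `[0, π]`, whose cosine moments are read off from the logarithmic potential. -/
theorem integral_cos_arccos_tan_half {m : Measure ℝ} [IsProbabilityMeasure m] {θ : ℝ}
    (hθ : 0 < θ) (hθπ : θ < Real.pi) (hm : m (Icc (-θ) θ)ᶜ = 0) {g : ℝ → ℝ}
    (hg : ContinuousOn g (Icc (-θ) θ)) (h : HasLogPotentialOn m θ g) {n : ℕ} (hn : n ≠ 0) :
    ∫ x in (0 : ℝ)..Real.pi,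
      (g (2 * Real.arctan (Real.tan (θ / 2) * Real.cos x)) -
        Real.log (Real.cos (Real.arctan (Real.tan (θ / 2) * Real.cos x)))) * Real.cos (n * x) =
      -(Real.pi / n) *
        ∫ y, Real.cos (n * Real.arccos (Real.tan (y / 2) / Real.tan (θ / 2))) ∂m := by
  set T := Real.tan (θ / 2) with hT
  have hTpos : 0 < T := Real.tan_pos_of_pos_of_lt_pi_div_two (by linarith) (by linarith)
  have hae : ∀ᵐ y ∂m, y ∈ Icc (-θ) θ := mem_ae_iff.2 hm
  have hτ := measurable_arccos_tan_half θ
  rw [← hT] at hτ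
  have hτmem : ∀ y ∈ Icc (-θ) θ, Real.cos (Real.arccos (Real.tan (y / 2) / T)) =
      Real.tan (y / 2) / T := fun y hy => cos_arccos_tan_half hθ hθπ hy
  have hβmem : ∀ x : ℝ, 2 * Real.arctan (T * Real.cos x) ∈ Icc (-θ) θ := by
    intro x
    have hθ2 : Real.arctan T = θ / 2 := Real.arctan_tan (by linarith) (by linarith)
    have h1 : Real.arctan (T * Real.cos x) ≤ Real.arctan T := Real.arctan_mono
      (mul_le_of_le_one_right hTpos.le (Real.cos_le_one x))
    have h2 : Real.arctan (-T) ≤ Real.arctan (T * Real.cos x) := Real.arctan_mono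
      (by nlinarith [Real.neg_one_le_cos x])
    rw [Real.arctan_neg] at h2
    constructor <;> linarith
  set c := ∫ y, Real.log (Real.cos (y / 2)) ∂m with hc
  have hcint : Integrable (fun y => Real.log (Real.cos (y / 2))) m := by
    refine integrable_of_continuous_of_measure_compl_Icc hm ?_
    exact ContinuousOn.log (by fun_prop) fun y hy => (cos_half_pos_of_mem hθπ hy).ne'
  have hL : ∀ x ∈ Icc 0 Real.pi, ∫ y, Real.log |Real.cos x - Real.cos y|
      ∂(m.map fun y : ℝ => Real.arccos (Real.tan (y / 2) / T)) =
      (g (2 * Real.arctan (T * Real.cos x)) - Real.log (Real.cos (Real.arctan (T * Real.cos x)))) -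
        (Real.log 2 + Real.log T + c) := by
    intro x _
    rw [integral_map hτ.aemeasurable
      (by fun_prop : Measurable fun y => Real.log |Real.cos x - Real.cos y|).aestronglyMeasurable]
    set z := 2 * Real.arctan (T * Real.cos x) with hz
    obtain ⟨h1, h2, h3⟩ := h z (hβmem x)
    have hcz := cos_half_pos_of_mem hθπ (hβmem x)
    have hz2 : z / 2 = Real.arctan (T * Real.cos x) := by rw [hz]; ring
    have hcos : Real.cos x = Real.tan (z / 2) / T := by
      rw [hz2, Real.tan_arctan]; field_simp
    have hfun : (fun y => Real.log |Real.cos x - Real.cos (Real.arccos (Real.tan (y / 2) / T))|)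
        =ᵐ[m] fun y => Real.log (chord z y) - Real.log (Real.cos (y / 2)) -
          (Real.log 2 + Real.log T + Real.log (Real.cos (z / 2))) := by
      filter_upwards [h1, hae] with y hy hyθ
      have hcy := cos_half_pos_of_mem hθπ hyθ
      have hs : |Real.sin ((z - y) / 2)| ≠ 0 := fun h0 => hy (by rw [chord_eq, h0, mul_zero])
      rw [hτmem y hyθ, hcos, ← sub_div, tan_half_sub_tan_half hcz.ne' hcy.ne', div_div, abs_div,
        abs_of_pos (by positivity : 0 < Real.cos (z / 2) * Real.cos (y / 2) * T), chord_eq,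
        Real.log_div hs (by positivity), Real.log_mul (by positivity) hTpos.ne',
        Real.log_mul hcz.ne' hcy.ne', Real.log_mul two_ne_zero hs]
      ring
    have h2c : Integrable (fun y => Real.log (chord z y) - Real.log (Real.cos (y / 2))) m :=
      h2.sub hcint
    rw [integral_congr_ae hfun, integral_sub h2c (integrable_const _),
      integral_sub h2 hcint, h3, ← hc, ← hz2]
    simp
    ring
  have : IsProbabilityMeasure (m.map fun y : ℝ => Real.arccos (Real.tan (y / 2) / T)) :=
    Measure.isProbabilityMeasure_map hτ.aemeasurable
  have key := integral_potential_mul_cos _ hL hn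
  rw [integral_map hτ.aemeasurable
    (by fun_prop : Measurable fun y : ℝ => Real.cos (n * y)).aestronglyMeasurable] at key
  rw [← key]
  have hcont : ContinuousOn (fun x : ℝ => (g (2 * Real.arctan (T * Real.cos x)) -
      Real.log (Real.cos (Real.arctan (T * Real.cos x)))) * Real.cos (n * x))
      (uIcc 0 Real.pi) := by
    refine ContinuousOn.mul (ContinuousOn.sub (hg.comp ?_ fun x _ => hβmem x) ?_) (by fun_prop)
    · exact (continuous_const.mul (Real.continuous_arctan.comp (by fun_prop))).continuousOn
    · exact ((Real.continuous_cos.comp (Real.continuous_arctan.comp (by fun_prop))).log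
        fun x => (Real.cos_arctan_pos _).ne').continuousOn
  simp_rw [sub_mul _ (Real.log 2 + Real.log T + c)]
  rw [intervalIntegral.integral_sub hcont.intervalIntegrable
    (Continuous.intervalIntegrable (by fun_prop) _ _), intervalIntegral.integral_const_mul,
    integral_cos_nat_mul hn, mul_zero, sub_zero]

/-- A unit measure on the arc `[-θ, θ]` is determined by its logarithmic potential there. -/
theorem HasLogPotentialOn.unique {m₁ m₂ : Measure ℝ} [IsProbabilityMeasure m₁]
    [IsProbabilityMeasure m₂] {θ : ℝ} (hθ : 0 < θ) (hθπ : θ < Real.pi)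
    (hm₁ : m₁ (Icc (-θ) θ)ᶜ = 0) (hm₂ : m₂ (Icc (-θ) θ)ᶜ = 0) {g : ℝ → ℝ}
    (hg : ContinuousOn g (Icc (-θ) θ)) (h₁ : HasLogPotentialOn m₁ θ g)
    (h₂ : HasLogPotentialOn m₂ θ g) : m₁ = m₂ := by
  have hτ := measurable_arccos_tan_half θ
  set τ : ℝ → ℝ := fun y => Real.arccos (Real.tan (y / 2) / Real.tan (θ / 2)) with hτdef
  have hσ : Measurable fun u : ℝ => 2 * Real.arctan (Real.tan (θ / 2) * Real.cos u) :=
    (Real.continuous_arctan.measurable.comp (by fun_prop)).const_mul 2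
  have hT : Real.tan (θ / 2) ≠ 0 :=
    (Real.tan_pos_of_pos_of_lt_pi_div_two (by linarith) (by linarith)).ne'
  have hback : ∀ m : Measure ℝ, m (Icc (-θ) θ)ᶜ = 0 →
      (m.map τ).map (fun u : ℝ => 2 * Real.arctan (Real.tan (θ / 2) * Real.cos u)) = m := by
    intro m hm
    rw [Measure.map_map hσ hτ]
    have hid : ((fun u : ℝ => 2 * Real.arctan (Real.tan (θ / 2) * Real.cos u)) ∘ τ) =ᵐ[m] id := by
      filter_upwards [mem_ae_iff.2 hm] with y hy
      simp only [Function.comp, hτdef, id]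
      rw [cos_arccos_tan_half hθ hθπ hy, mul_div_cancel₀ _ hT,
        Real.arctan_tan (by linarith [hy.1]) (by linarith [hy.2])]
      ring
    rw [Measure.map_congr hid, Measure.map_id]
  have hnull : ∀ m : Measure ℝ, (m.map τ) (Icc 0 Real.pi)ᶜ = 0 := by
    intro m
    rw [Measure.map_apply hτ measurableSet_Icc.compl]
    have : τ ⁻¹' (Icc 0 Real.pi)ᶜ = ∅ := by
      ext y
      simp only [mem_preimage, mem_compl_iff, mem_empty_iff_false, iff_false, not_not]
      exact ⟨Real.arccos_nonneg _, Real.arccos_le_pi _⟩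
    rw [this, measure_empty]
  have p₁ : IsProbabilityMeasure (m₁.map τ) := Measure.isProbabilityMeasure_map hτ.aemeasurable
  have p₂ : IsProbabilityMeasure (m₂.map τ) := Measure.isProbabilityMeasure_map hτ.aemeasurable
  have hκ : m₁.map τ = m₂.map τ := by
    refine ext_of_integral_cos_eq (hnull _) (hnull _) fun n => ?_
    rcases eq_or_ne n 0 with rfl | hn
    · simp
    · have hmeas : Measurable fun y : ℝ => Real.cos (n * y) := by fun_prop
      rw [integral_map hτ.aemeasurable hmeas.aestronglyMeasurable,
        integral_map hτ.aemeasurable hmeas.aestronglyMeasurable]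
      have e := (integral_cos_arccos_tan_half hθ hθπ hm₁ hg h₁ hn).symm.trans
        (integral_cos_arccos_tan_half hθ hθπ hm₂ hg h₂ hn)
      have hne : -(Real.pi / n) ≠ 0 :=
        neg_ne_zero.2 (div_ne_zero Real.pi_ne_zero (by exact_mod_cast hn))
      exact mul_left_cancel₀ hne e
  rw [← hback m₁ hm₁, hκ, hback m₂ hm₂]

/-- A unit measure on the arc `[-θ, θ]` with an even logarithmic potential is even. -/
theorem HasLogPotentialOn.map_neg_eq {m : Measure ℝ} [IsProbabilityMeasure m] {θ : ℝ}
    (hθ : 0 < θ) (hθπ : θ < Real.pi) (hm : m (Icc (-θ) θ)ᶜ = 0) {g : ℝ → ℝ}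
    (hg : ContinuousOn g (Icc (-θ) θ)) (heven : ∀ x, g (-x) = g x)
    (h : HasLogPotentialOn m θ g) : m.map (fun x => -x) = m := by
  have p : IsProbabilityMeasure (m.map fun x => -x) :=
    Measure.isProbabilityMeasure_map measurable_neg.aemeasurable
  refine HasLogPotentialOn.unique hθ hθπ ?_ hm hg (h.map_neg heven) h
  rw [Measure.map_apply measurable_neg measurableSet_Icc.compl]
  convert hm using 2
  ext x
  simp only [mem_preimage, mem_compl_iff, mem_Icc, neg_le_neg_iff, neg_le (b := θ), and_comm]

theorem sin_half_sub_mul_sin_half_add (x y : ℝ) :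
    (Real.sin (x / 2) - Real.sin (y / 2)) * (Real.sin (x / 2) + Real.sin (y / 2)) =
      Real.sin ((x - y) / 2) * Real.sin ((x + y) / 2) := by
  rw [sub_div, add_div, Real.sin_sub, Real.sin_add]
  linear_combination Real.sin (y / 2) ^ 2 * Real.sin_sq_add_cos_sq (x / 2) -
    Real.sin (x / 2) ^ 2 * Real.sin_sq_add_cos_sq (y / 2)

/-- For an even measure the kernel `log |2 sin ((x - y) / 2)|` may be replaced by
`log (2 |sin (x / 2) - sin (y / 2)|)`, since symmetrizing in `y` gives the same result for both. -/
theorem HasLogPotentialOn.integral_log_abs_sin_half_sub {m : Measure ℝ} [IsProbabilityMeasure m]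
    {θ : ℝ} {g : ℝ → ℝ} (h : HasLogPotentialOn m θ g) (hneg : m.map (fun x => -x) = m) {x : ℝ}
    (hx : x ∈ Icc (-θ) θ) :
    (∀ᵐ y ∂m, Real.sin (x / 2) - Real.sin (y / 2) ≠ 0) ∧
    Integrable (fun y => Real.log |Real.sin (x / 2) - Real.sin (y / 2)|) m ∧
    ∫ y, Real.log |Real.sin (x / 2) - Real.sin (y / 2)| ∂m = g x - Real.log 2 := by
  have hemb : MeasurableEmbedding fun x : ℝ => -x := measurableEmbedding_neg
  obtain ⟨h1, h2, h3⟩ := h x hx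
  have h1' : ∀ᵐ y ∂m, chord x (-y) ≠ 0 := hemb.ae_map_iff.1 (by rwa [hneg])
  have hflip : ∀ F : ℝ → ℝ, ∫ y, F (-y) ∂m = ∫ y, F y ∂m := fun F => by
    rw [← hemb.integral_map, hneg]
  have hflipI : ∀ F : ℝ → ℝ, Integrable F m → Integrable (fun y => F (-y)) m := fun F hF =>
    hemb.integrable_map_iff.1 (by rwa [hneg])
  set A : ℝ → ℝ := fun y => Real.log |Real.sin (x / 2) - Real.sin (y / 2)| with hA
  set l : ℝ → ℝ := fun y => Real.log (chord x y) - Real.log 2 with hl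
  have hlint : Integrable l m := h2.sub (integrable_const _)
  have hkey : ∀ᵐ y ∂m, Real.sin (x / 2) - Real.sin (y / 2) ≠ 0 ∧ A y + A (-y) = l y + l (-y) := by
    filter_upwards [h1, h1'] with y hy hy'
    have e := sin_half_sub_mul_sin_half_add x y
    have hs : Real.sin ((x - y) / 2) ≠ 0 := fun h0 => hy (by rw [chord_eq, h0]; simp)
    have hs' : Real.sin ((x + y) / 2) ≠ 0 := fun h0 => hy' (by
      rw [chord_eq, sub_neg_eq_add, h0]; simp)
    have hprod : (Real.sin (x / 2) - Real.sin (y / 2)) *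
        (Real.sin (x / 2) + Real.sin (y / 2)) ≠ 0 := by
      rw [e]; exact mul_ne_zero hs hs'
    refine ⟨left_ne_zero_of_mul hprod, ?_⟩
    simp only [hA, hl, neg_div, Real.sin_neg, sub_neg_eq_add, Real.log_abs, chord_eq]
    rw [← Real.log_mul (left_ne_zero_of_mul hprod) (right_ne_zero_of_mul hprod), e,
      Real.log_mul two_ne_zero (abs_ne_zero.2 hs), Real.log_mul two_ne_zero (abs_ne_zero.2 hs'),
      Real.log_abs, Real.log_abs, Real.log_mul hs hs']
    ring
  -- `A` is bounded above, so the integrability of `A y + A (-y)` also bounds it below.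
  have hAle : ∀ y, A y ≤ Real.log 2 := by
    intro y
    rcases eq_or_ne (Real.sin (x / 2) - Real.sin (y / 2)) 0 with h0 | h0
    · simp only [hA, h0, abs_zero, Real.log_zero]; exact Real.log_nonneg one_le_two
    · refine Real.log_le_log (abs_pos.2 h0) (abs_le.2 ⟨?_, ?_⟩) <;>
        linarith [Real.sin_le_one (x / 2), Real.sin_le_one (y / 2), Real.neg_one_le_sin (x / 2),
          Real.neg_one_le_sin (y / 2)]
  have hAmeas : Measurable A := by fun_prop
  have hAint : Integrable A m := by
    refine ((hlint.add (hflipI l hlint)).norm.add (integrable_const (Real.log 2))).mono'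
      hAmeas.aestronglyMeasurable ?_
    filter_upwards [hkey] with y hy
    have h4 := hAle y
    have h5 := hAle (-y)
    have h6 := neg_abs_le (l y + l (-y))
    have h7 := Real.log_nonneg one_le_two
    simp only [Pi.add_apply, Real.norm_eq_abs]
    rw [abs_le]
    constructor
    · linarith [hy.2]
    · linarith [abs_nonneg (l y + l (-y))]
  refine ⟨hkey.mono fun y hy => hy.1, hAint, ?_⟩
  have e1 : ∫ y, A y + A (-y) ∂m = ∫ y, l y + l (-y) ∂m :=
    integral_congr_ae (hkey.mono fun y hy => hy.2)
  rw [integral_add hAint (hflipI A hAint), integral_add hlint (hflipI l hlint), hflip A,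
    hflip l] at e1
  have e2 : ∫ y, l y ∂m = g x - Real.log 2 := by
    simp only [hl]
    rw [integral_sub h2 (integrable_const _), h3]; simp
  linarith

/-! ### The parametrization of the arc -/

/-- The point `x ∈ [-θ, θ]` with `sin (x / 2) = sin (θ / 2) cos φ`. -/
def arcPoint (θ φ : ℝ) : ℝ := 2 * Real.arcsin (Real.sin (θ / 2) * Real.cos φ)

/-- The angle `φ ∈ [0, π]` with `sin (x / 2) = sin (θ / 2) cos φ`, for `x ∈ [-θ, θ]`. -/
def arcAngle (θ x : ℝ) : ℝ := Real.arccos (Real.sin (x / 2) / Real.sin (θ / 2))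

section

variable {θ : ℝ}

theorem sin_half_pos (hθ : 0 < θ) (hθπ : θ < Real.pi) : 0 < Real.sin (θ / 2) :=
  Real.sin_pos_of_pos_of_lt_pi (by linarith) (by linarith)

theorem sin_half_lt_one (hθ : 0 < θ) (hθπ : θ < Real.pi) : Real.sin (θ / 2) < 1 := by
  have h1 := Real.cos_pos_of_mem_Ioo (x := θ / 2) ⟨by linarith, by linarith⟩
  nlinarith [Real.sin_sq_add_cos_sq (θ / 2), sin_half_pos hθ hθπ]

theorem abs_sin_half_mul_cos_lt_one (hθ : 0 < θ) (hθπ : θ < Real.pi) (φ : ℝ) :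
    |Real.sin (θ / 2) * Real.cos φ| < 1 := by
  rw [abs_mul, abs_of_pos (sin_half_pos hθ hθπ)]
  calc _ ≤ Real.sin (θ / 2) * 1 :=
        mul_le_mul_of_nonneg_left (Real.abs_cos_le_one _) (sin_half_pos hθ hθπ).le
    _ < 1 := by linarith [sin_half_lt_one hθ hθπ]

theorem arcPoint_half (φ : ℝ) :
    arcPoint θ φ / 2 = Real.arcsin (Real.sin (θ / 2) * Real.cos φ) := by
  rw [arcPoint]; ring

theorem sin_arcPoint_half (hθ : 0 < θ) (hθπ : θ < Real.pi) (φ : ℝ) :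
    Real.sin (arcPoint θ φ / 2) = Real.sin (θ / 2) * Real.cos φ := by
  have := abs_lt.1 (abs_sin_half_mul_cos_lt_one hθ hθπ φ)
  rw [arcPoint_half, Real.sin_arcsin this.1.le this.2.le]

theorem continuous_arcPoint : Continuous (arcPoint θ) :=
  continuous_const.mul (Real.continuous_arcsin.comp (by fun_prop))

theorem measurable_arcAngle : Measurable (arcAngle θ) :=
  Real.continuous_arccos.measurable.comp (by fun_prop)

theorem continuous_arcAngle : Continuous (arcAngle θ) :=
  Real.continuous_arccos.comp (by fun_prop)

theorem arcAngle_mem (x : ℝ) : arcAngle θ x ∈ Icc 0 Real.pi :=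
  ⟨Real.arccos_nonneg _, Real.arccos_le_pi _⟩

theorem arcPoint_zero (hθ : 0 < θ) (hθπ : θ < Real.pi) : arcPoint θ 0 = θ := by
  rw [arcPoint, Real.cos_zero, mul_one, Real.arcsin_sin (by linarith) (by linarith)]; ring

theorem arcPoint_pi_sub (φ : ℝ) : arcPoint θ (Real.pi - φ) = -arcPoint θ φ := by
  rw [arcPoint, arcPoint, Real.cos_pi_sub, mul_neg, Real.arcsin_neg]; ring

theorem sin_half_strictMonoOn (hθπ : θ < Real.pi) :
    StrictMonoOn (fun x : ℝ => Real.sin (x / 2)) (Icc (-θ) θ) := fun x hx y hy hxy =>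
  Real.strictMonoOn_sin ⟨by linarith [hx.1], by linarith [hx.2]⟩
    ⟨by linarith [hy.1], by linarith [hy.2]⟩ (by linarith)

theorem sin_half_mem_Icc (hθ : 0 < θ) (hθπ : θ < Real.pi) {x : ℝ} (hx : x ∈ Icc (-θ) θ) :
    Real.sin (x / 2) / Real.sin (θ / 2) ∈ Icc (-1 : ℝ) 1 := by
  have ha := sin_half_pos hθ hθπ
  have hmono := (sin_half_strictMonoOn hθπ).monotoneOn
  have h1 := hmono hx ⟨by linarith, le_rfl⟩ hx.2
  have h2 := hmono ⟨le_rfl, by linarith⟩ hx hx.1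
  simp only [neg_div, Real.sin_neg] at h1 h2
  rw [mem_Icc, le_div_iff₀ ha, div_le_one ha]
  constructor <;> linarith

theorem cos_arcAngle (hθ : 0 < θ) (hθπ : θ < Real.pi) {x : ℝ} (hx : x ∈ Icc (-θ) θ) :
    Real.cos (arcAngle θ x) = Real.sin (x / 2) / Real.sin (θ / 2) :=
  Real.cos_arccos (sin_half_mem_Icc hθ hθπ hx).1 (sin_half_mem_Icc hθ hθπ hx).2

theorem arcPoint_arcAngle (hθ : 0 < θ) (hθπ : θ < Real.pi) {x : ℝ} (hx : x ∈ Icc (-θ) θ) :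
    arcPoint θ (arcAngle θ x) = x := by
  rw [arcPoint, cos_arcAngle hθ hθπ hx, mul_div_cancel₀ _ (sin_half_pos hθ hθπ).ne',
    Real.arcsin_sin (by linarith [hx.1]) (by linarith [hx.2])]
  ring

theorem arcAngle_arcPoint (hθ : 0 < θ) (hθπ : θ < Real.pi) {φ : ℝ} (hφ : φ ∈ Icc 0 Real.pi) :
    arcAngle θ (arcPoint θ φ) = φ := by
  rw [arcAngle, sin_arcPoint_half hθ hθπ, mul_div_cancel_left₀ _ (sin_half_pos hθ hθπ).ne',
    Real.arccos_cos hφ.1 hφ.2]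

theorem arcPoint_mem (hθ : 0 < θ) (hθπ : θ < Real.pi) (φ : ℝ) :
    arcPoint θ φ ∈ Icc (-θ) θ := by
  have ha := sin_half_pos hθ hθπ
  have e : Real.arcsin (Real.sin (θ / 2)) = θ / 2 := Real.arcsin_sin (by linarith) (by linarith)
  have h1 : Real.arcsin (Real.sin (θ / 2) * Real.cos φ) ≤ θ / 2 := by
    rw [← e]
    refine Real.monotone_arcsin ?_
    rw [e]; exact mul_le_of_le_one_right ha.le (Real.cos_le_one φ)
  have h2 : -(θ / 2) ≤ Real.arcsin (Real.sin (θ / 2) * Real.cos φ) := by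
    rw [← e, ← Real.arcsin_neg]
    refine Real.monotone_arcsin ?_
    rw [e]; nlinarith [Real.neg_one_le_cos φ]
  rw [arcPoint]
  constructor <;> linarith

theorem cos_arcPoint_half_pos (hθ : 0 < θ) (hθπ : θ < Real.pi) (φ : ℝ) :
    0 < Real.cos (arcPoint θ φ / 2) :=
  cos_half_pos_of_mem hθπ (arcPoint_mem hθ hθπ φ)

theorem contDiff_arcPoint (hθ : 0 < θ) (hθπ : θ < Real.pi) : ContDiff ℝ 3 (arcPoint θ) := by
  rw [contDiff_iff_contDiffAt]
  intro φ
  have h := abs_lt.1 (abs_sin_half_mul_cos_lt_one hθ hθπ φ)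
  have h1 : ContDiffAt ℝ 3 Real.arcsin (Real.sin (θ / 2) * Real.cos φ) :=
    Real.contDiffAt_arcsin h.1.ne' h.2.ne
  have h2 : ContDiffAt ℝ 3 (fun φ => Real.sin (θ / 2) * Real.cos φ) φ :=
    contDiffAt_const.mul Real.contDiff_cos.contDiffAt
  have h3 : ContDiffAt ℝ 3 (Real.arcsin ∘ fun φ => Real.sin (θ / 2) * Real.cos φ) φ :=
    ContDiffAt.comp φ h1 h2
  exact contDiffAt_const.mul h3

theorem hasDerivAt_arcPoint (hθ : 0 < θ) (hθπ : θ < Real.pi) (φ : ℝ) :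
    HasDerivAt (arcPoint θ)
      (-(2 * Real.sin (θ / 2) * Real.sin φ / Real.cos (arcPoint θ φ / 2))) φ := by
  have h := abs_lt.1 (abs_sin_half_mul_cos_lt_one hθ hθπ φ)
  have h1 := ((Real.hasDerivAt_arcsin h.1.ne' h.2.ne).comp φ
    ((Real.hasDerivAt_cos φ).const_mul (Real.sin (θ / 2)))).const_mul 2
  refine h1.congr_deriv ?_
  rw [arcPoint_half, Real.cos_arcsin]
  ring

theorem cos_sub_cos_eq_sin_half (x y : ℝ) :
    Real.cos x - Real.cos y = 2 * (Real.sin (y / 2) ^ 2 - Real.sin (x / 2) ^ 2) := by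
  have h : ∀ z : ℝ, Real.cos z = 1 - 2 * Real.sin (z / 2) ^ 2 := fun z => by
    rw [Real.sin_sq, ← mul_div_cancel₀ z (two_ne_zero' ℝ), Real.cos_two_mul]
    ring_nf
  rw [h x, h y]; ring

theorem chi_arcPoint (hθ : 0 < θ) (hθπ : θ < Real.pi) {φ : ℝ} (hφ : φ ∈ Icc 0 Real.pi) :
    chi θ (arcPoint θ φ) = Real.sqrt 2 * Real.sin (θ / 2) * Real.sin φ := by
  have ha := sin_half_pos hθ hθπ
  have hs : 0 ≤ Real.sin φ := Real.sin_nonneg_of_mem_Icc hφ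
  rw [chi, cos_sub_cos_eq_sin_half, sin_arcPoint_half hθ hθπ]
  have e : 2 * (Real.sin (θ / 2) ^ 2 - (Real.sin (θ / 2) * Real.cos φ) ^ 2) =
      2 * (Real.sin (θ / 2) * Real.sin φ) ^ 2 := by
    rw [mul_pow, mul_pow, Real.sin_sq φ]; ring
  rw [e, abs_of_nonneg (by positivity), Real.sqrt_mul (by norm_num),
    Real.sqrt_sq (by positivity), mul_assoc]

theorem injOn_arcPoint (hθ : 0 < θ) (hθπ : θ < Real.pi) :
    InjOn (arcPoint θ) (Icc 0 Real.pi) := fun x hx y hy h => by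
  rw [← arcAngle_arcPoint hθ hθπ hx, h, arcAngle_arcPoint hθ hθπ hy]

theorem arcAngle_mem_Ioo (hθ : 0 < θ) (hθπ : θ < Real.pi) {x : ℝ} (hx : x ∈ Ioo (-θ) θ) :
    arcAngle θ x ∈ Ioo 0 Real.pi := by
  have hx' := Ioo_subset_Icc_self hx
  have hmem := arcAngle_mem (θ := θ) x
  refine ⟨hmem.1.lt_of_ne fun h => ?_, hmem.2.lt_of_ne fun h => ?_⟩
  · have := arcPoint_arcAngle hθ hθπ hx'
    rw [← h, arcPoint_zero hθ hθπ] at this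
    exact hx.2.ne this.symm
  · have := arcPoint_arcAngle hθ hθπ hx'
    rw [h, ← sub_zero Real.pi, arcPoint_pi_sub, arcPoint_zero hθ hθπ] at this
    exact hx.1.ne this

theorem image_arcPoint (hθ : 0 < θ) (hθπ : θ < Real.pi) :
    arcPoint θ '' Ioo 0 Real.pi = Ioo (-θ) θ := by
  ext x
  constructor
  · rintro ⟨φ, hφ, rfl⟩
    have hinj := injOn_arcPoint hθ hθπ
    have hmem := arcPoint_mem hθ hθπ φ
    have hφ' := Ioo_subset_Icc_self hφ
    refine ⟨hmem.1.lt_of_ne fun h => ?_, hmem.2.lt_of_ne fun h => ?_⟩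
    · have e : arcPoint θ Real.pi = arcPoint θ φ := by
        rw [← h, ← sub_zero Real.pi, arcPoint_pi_sub, arcPoint_zero hθ hθπ]
      exact hφ.2.ne' (hinj ⟨Real.pi_pos.le, le_rfl⟩ hφ' e)
    · exact hφ.1.ne' (hinj hφ' ⟨le_rfl, Real.pi_pos.le⟩ (h.trans (arcPoint_zero hθ hθπ).symm))
  · exact fun hx => ⟨arcAngle θ x, arcAngle_mem_Ioo hθ hθπ hx,
      arcPoint_arcAngle hθ hθπ (Ioo_subset_Icc_self hx)⟩

end

/-! ### Cosine moments of the equilibrium measure -/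

theorem ConditionC3.exists_contDiffOn {V : ℝ → ℝ} {θ : ℝ} (h : ConditionC3 V θ) :
    ∃ ε : ℝ, 0 < ε ∧ ContDiffOn ℝ 3 (fun x => V (Real.cos x)) (Ioo (-θ - ε) (θ + ε)) := by
  obtain ⟨ε, hε, hd, -⟩ := h
  refine ⟨ε, hε, ContDiffOn.mono (t := Ioo (-θ - ε) (θ + ε)) ?_ Subset.rfl⟩
  have h3 : ContDiffOn ℝ (3 : ℕ∞) (fun x => V (Real.cos x)) (Icc (-θ - ε) (θ + ε)) :=
    contDiffOn_of_differentiableOn_deriv fun k hk => hd k (by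
      have : k ≤ 3 := by exact_mod_cast hk
      omega)
  exact h3.mono Ioo_subset_Icc_self

/-- Three integrations by parts; the vanishing of `F'` at both ends removes the boundary terms of
the second one. -/
theorem exists_abs_integral_mul_cos_le {F : ℝ → ℝ} (hF : ContDiff ℝ 3 F) (h0 : deriv F 0 = 0)
    (hpi : deriv F Real.pi = 0) :
    ∃ C : ℝ, ∀ n : ℕ, n ≠ 0 →
      |∫ x in (0 : ℝ)..Real.pi, F x * Real.cos (n * x)| ≤ C / (n : ℝ) ^ 3 := by
  have c1 : ContDiff ℝ 2 (deriv F) := hF.deriv'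
  have c2 : ContDiff ℝ 1 (deriv (deriv F)) := c1.deriv'
  have c3 : Continuous (deriv (deriv (deriv F))) := c2.continuous_deriv le_rfl
  have d0 : ∀ x, HasDerivAt F (deriv F x) x := fun x =>
    (hF.differentiable (by norm_num) x).hasDerivAt
  have d1 : ∀ x, HasDerivAt (deriv F) (deriv (deriv F) x) x := fun x =>
    (c1.differentiable (by norm_num) x).hasDerivAt
  have d2 : ∀ x, HasDerivAt (deriv (deriv F)) (deriv (deriv (deriv F)) x) x := fun x =>
    (c2.differentiable (by norm_num) x).hasDerivAt
  have hsin : ∀ (n : ℕ) (x : ℝ),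
      HasDerivAt (fun x : ℝ => Real.sin (n * x)) (n * Real.cos (n * x)) x := fun n x => by
    simpa [mul_comm] using ((hasDerivAt_id x).const_mul (n : ℝ)).sin
  have hcos : ∀ (n : ℕ) (x : ℝ),
      HasDerivAt (fun x : ℝ => -Real.cos (n * x)) (n * Real.sin (n * x)) x := fun n x =>
    ((hasDerivAt_id x).const_mul (n : ℝ)).cos.neg.congr_deriv (by simp [mul_comm])
  have byparts_cos : ∀ (u u' : ℝ → ℝ) (n : ℕ), (∀ x, HasDerivAt u (u' x) x) → Continuous u' →
      (n : ℝ) * ∫ x in (0 : ℝ)..Real.pi, u x * Real.cos (n * x) =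
        -∫ x in (0 : ℝ)..Real.pi, u' x * Real.sin (n * x) := by
    intro u u' n hu hu'
    have := intervalIntegral.integral_mul_deriv_eq_deriv_mul (a := 0) (b := Real.pi)
      (fun x _ => hu x) (fun x _ => hsin n x) (hu'.intervalIntegrable _ _)
      (Continuous.intervalIntegrable (by fun_prop) _ _)
    rw [← intervalIntegral.integral_const_mul]
    simp only [Real.sin_nat_mul_pi, mul_zero, Real.sin_zero, sub_zero, zero_sub] at this
    rw [← this]
    exact intervalIntegral.integral_congr fun x _ => by ring
  obtain ⟨C, hC⟩ := isCompact_Icc.exists_bound_of_continuousOn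
    (c3.continuousOn (s := Icc 0 Real.pi))
  refine ⟨C * Real.pi, fun n hn => ?_⟩
  have hn' : 0 < (n : ℝ) := by exact_mod_cast Nat.pos_of_ne_zero hn
  have e1 := byparts_cos F _ n d0 (c1.continuous)
  have e2 : (n : ℝ) * ∫ x in (0 : ℝ)..Real.pi, deriv F x * Real.sin (n * x) =
      ∫ x in (0 : ℝ)..Real.pi, deriv (deriv F) x * Real.cos (n * x) := by
    have := intervalIntegral.integral_mul_deriv_eq_deriv_mul (a := 0) (b := Real.pi)
      (fun x _ => d1 x) (fun x _ => hcos n x) (c2.continuous.intervalIntegrable _ _)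
      (Continuous.intervalIntegrable (by fun_prop) _ _)
    rw [← intervalIntegral.integral_const_mul]
    simp only [h0, hpi, zero_mul, mul_neg, intervalIntegral.integral_neg, neg_zero, sub_zero,
      zero_sub, neg_neg] at this
    rw [← this]
    exact intervalIntegral.integral_congr fun x _ => by ring
  have e3 := byparts_cos _ _ n d2 c3
  have e4 : (n : ℝ) ^ 3 * ∫ x in (0 : ℝ)..Real.pi, F x * Real.cos (n * x) =
      ∫ x in (0 : ℝ)..Real.pi, deriv (deriv (deriv F)) x * Real.sin (n * x) := by
    calc _ = (n : ℝ) * (n * (n * ∫ x in (0 : ℝ)..Real.pi, F x * Real.cos (n * x))) := by ring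
      _ = _ := by rw [e1, mul_neg, e2, mul_neg, e3, neg_neg]
  have e5 : ‖∫ x in (0 : ℝ)..Real.pi, deriv (deriv (deriv F)) x * Real.sin (n * x)‖ ≤
      C * |Real.pi - 0| := by
    refine intervalIntegral.norm_integral_le_of_norm_le_const fun x hx => ?_
    rw [uIoc_of_le Real.pi_pos.le] at hx
    rw [norm_mul]
    exact (mul_le_of_le_one_right (norm_nonneg _) (Real.abs_sin_le_one _)).trans
      (hC x (Ioc_subset_Icc_self hx))
  rw [sub_zero, abs_of_pos Real.pi_pos, ← e4, norm_mul, Real.norm_eq_abs, Real.norm_eq_abs,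
    abs_of_pos (by positivity)] at e5
  rw [le_div_iff₀ (by positivity)]
  linarith

/-- The angular cosine moments of an even unit measure on the arc, in the coordinate
`sin (x / 2) = sin (θ / 2) cos φ`. -/
theorem integral_cos_arcAngle {m : Measure ℝ} [IsProbabilityMeasure m] {θ : ℝ}
    (hθ : 0 < θ) (hθπ : θ < Real.pi) (hm : m (Icc (-θ) θ)ᶜ = 0) (hneg : m.map (fun x => -x) = m)
    {f : ℝ → ℝ} (hf : Continuous fun φ => f (arcPoint θ φ)) {ℓ : ℝ}
    (h : HasLogPotentialOn m θ fun x => (f x - ℓ) / 2) {n : ℕ} (hn : n ≠ 0) :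
    ∫ x, Real.cos (n * x) ∂(m.map (arcAngle θ)) =
      -(n / (2 * Real.pi)) * ∫ φ in (0 : ℝ)..Real.pi, f (arcPoint θ φ) * Real.cos (n * φ) := by
  set a := Real.sin (θ / 2) with ha
  have hapos : 0 < a := sin_half_pos hθ hθπ
  have hae : ∀ᵐ y ∂m, y ∈ Icc (-θ) θ := mem_ae_iff.2 hm
  have hτ : Measurable (arcAngle θ) := measurable_arcAngle
  have hL : ∀ x ∈ Icc 0 Real.pi, ∫ y, Real.log |Real.cos x - Real.cos y|
      ∂(m.map (arcAngle θ)) = 1 / 2 * f (arcPoint θ x) - (ℓ / 2 + Real.log 2 + Real.log a) := by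
    intro x _
    rw [integral_map hτ.aemeasurable
      (by fun_prop : Measurable fun y => Real.log |Real.cos x - Real.cos y|).aestronglyMeasurable]
    obtain ⟨h1, h2, h3⟩ := h.integral_log_abs_sin_half_sub hneg (arcPoint_mem hθ hθπ x)
    have hfun : (fun y => Real.log |Real.cos x - Real.cos (arcAngle θ y)|) =ᵐ[m]
        fun y => Real.log |Real.sin (arcPoint θ x / 2) - Real.sin (y / 2)| - Real.log a := by
      filter_upwards [h1, hae] with y hy hyθ
      have hcos : Real.cos x = Real.sin (arcPoint θ x / 2) / a := by
        rw [sin_arcPoint_half hθ hθπ]; field_simp; rfl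
      rw [cos_arcAngle hθ hθπ hyθ, hcos, ← sub_div, abs_div, abs_of_pos hapos,
        Real.log_div (abs_ne_zero.2 hy) hapos.ne']
    rw [integral_congr_ae hfun, integral_sub h2 (integrable_const _), h3]
    simp
    ring
  have : IsProbabilityMeasure (m.map (arcAngle θ)) :=
    Measure.isProbabilityMeasure_map hτ.aemeasurable
  have key := integral_potential_mul_cos _ hL hn
  simp_rw [sub_mul, mul_assoc] at key
  have hI : IntervalIntegrable (fun φ => 1 / 2 * (f (arcPoint θ φ) * Real.cos (n * φ))) volume 0
      Real.pi := (continuous_const.mul (hf.mul (by fun_prop))).intervalIntegrable _ _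
  rw [intervalIntegral.integral_sub hI
    (Continuous.intervalIntegrable (by fun_prop) _ _), intervalIntegral.integral_const_mul,
    intervalIntegral.integral_const_mul, integral_cos_nat_mul hn, mul_zero, sub_zero] at key
  have hn' : (n : ℝ) ≠ 0 := by exact_mod_cast hn
  have hπ := Real.pi_ne_zero
  field_simp at key ⊢
  linarith

/-- Half the derivative of `f(x)` with respect to `sin (x / 2)`, for `cos (x / 2) ≠ 0`. -/
def reducedDeriv (f : ℝ → ℝ) (x : ℝ) : ℝ := deriv f x / Real.cos (x / 2)

/-- Integration by parts expresses the cosine transform of `f ∘ arcPoint θ` through that of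
`reducedDeriv f ∘ arcPoint θ`. -/
theorem integral_comp_arcPoint_mul_cos {θ : ℝ} (hθ : 0 < θ) (hθπ : θ < Real.pi) {f : ℝ → ℝ}
    (hf : ∀ x ∈ Icc (-θ) θ, DifferentiableAt ℝ f x)
    (hR : Continuous fun φ => reducedDeriv f (arcPoint θ φ)) (n : ℕ) :
    ((n + 1 : ℕ) : ℝ) * ∫ φ in (0 : ℝ)..Real.pi, f (arcPoint θ φ) * Real.cos ((n + 1 : ℕ) * φ) =
      Real.sin (θ / 2) *
        ((∫ φ in (0 : ℝ)..Real.pi, reducedDeriv f (arcPoint θ φ) * Real.cos (n * φ)) -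
        ∫ φ in (0 : ℝ)..Real.pi, reducedDeriv f (arcPoint θ φ) * Real.cos ((n + 2 : ℕ) * φ)) := by
  set a := Real.sin (θ / 2) with ha
  have hF : ∀ φ, HasDerivAt (fun φ => f (arcPoint θ φ))
      (-(2 * a * Real.sin φ * reducedDeriv f (arcPoint θ φ))) φ := by
    intro φ
    have := (hf _ (arcPoint_mem hθ hθπ φ)).hasDerivAt.comp φ (hasDerivAt_arcPoint hθ hθπ φ)
    refine this.congr_deriv ?_
    rw [reducedDeriv]; ring
  have hsin : ∀ x : ℝ, HasDerivAt (fun x : ℝ => Real.sin ((n + 1 : ℕ) * x))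
      ((n + 1 : ℕ) * Real.cos ((n + 1 : ℕ) * x)) x := fun x => by
    simpa [mul_comm, -Nat.cast_add] using
      ((hasDerivAt_id x).const_mul ((n + 1 : ℕ) : ℝ)).sin
  have key := intervalIntegral.integral_mul_deriv_eq_deriv_mul (a := 0) (b := Real.pi)
    (fun x _ => hF x) (fun x _ => hsin x) (Continuous.intervalIntegrable (by fun_prop) _ _)
    (Continuous.intervalIntegrable (by fun_prop) _ _)
  simp only [Real.sin_nat_mul_pi, mul_zero, Real.sin_zero, sub_zero, zero_sub] at key
  rw [← intervalIntegral.integral_const_mul, ← intervalIntegral.integral_sub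
    (Continuous.intervalIntegrable (by fun_prop) _ _)
    (Continuous.intervalIntegrable (by fun_prop) _ _), ← intervalIntegral.integral_const_mul]
  simp_rw [mul_left_comm _ (f _)]
  rw [key, ← intervalIntegral.integral_neg]
  refine intervalIntegral.integral_congr fun φ _ => ?_
  have e1 : (n : ℝ) * φ = (n + 1 : ℕ) * φ - φ := by push_cast; ring
  have e2 : ((n + 2 : ℕ) : ℝ) * φ = (n + 1 : ℕ) * φ + φ := by push_cast; ring
  rw [e1, e2, Real.cos_add, Real.cos_sub]
  ring

/-! ### The density on the arc -/

/-- The density on `[-θ, θ]` of the image under `arcPoint θ` of the measure `h(φ) dφ` on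
`[0, π]`. -/
def arcDensity (θ : ℝ) (h : ℝ → ℝ) : ℝ → ℝ :=
  (Ioo (-θ) θ).indicator fun x => h (arcAngle θ x) * (Real.cos (x / 2) / (Real.sqrt 2 * chi θ x))

theorem continuous_chi (θ : ℝ) : Continuous (chi θ) :=
  ((Real.continuous_cos.sub continuous_const).abs).sqrt

theorem measurable_arcDensity {θ : ℝ} {h : ℝ → ℝ} (hh : Continuous h) :
    Measurable (arcDensity θ h) := by
  have h1 := (hh.comp (continuous_arcAngle (θ := θ))).measurable
  have h2 := (continuous_chi θ).measurable
  exact (h1.mul (by fun_prop)).indicator measurableSet_Ioo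

theorem chi_pos {θ x : ℝ} (hθπ : θ < Real.pi) (hx : x ∈ Ioo (-θ) θ) : 0 < chi θ x := by
  refine Real.sqrt_pos.2 (abs_pos.2 (sub_pos.2 ?_).ne')
  rw [← Real.cos_abs x]
  exact Real.cos_lt_cos_of_nonneg_of_le_pi (abs_nonneg x) hθπ.le (abs_lt.2 hx)

theorem arcDensity_nonneg {θ : ℝ} {h : ℝ → ℝ} (hθπ : θ < Real.pi)
    (hh : ∀ φ ∈ Icc 0 Real.pi, 0 ≤ h φ) (x : ℝ) : 0 ≤ arcDensity θ h x := by
  refine indicator_nonneg (fun x hx => ?_) x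
  have h1 := hh _ (arcAngle_mem (θ := θ) x)
  have h2 := cos_half_pos_of_mem hθπ (Ioo_subset_Icc_self hx)
  have h3 := chi_pos hθπ hx
  positivity

theorem abs_deriv_arcPoint {θ φ : ℝ} (hθ : 0 < θ) (hθπ : θ < Real.pi) (hφ : φ ∈ Ioo 0 Real.pi) :
    |(-(2 * Real.sin (θ / 2) * Real.sin φ / Real.cos (arcPoint θ φ / 2)))| =
      2 * Real.sin (θ / 2) * Real.sin φ / Real.cos (arcPoint θ φ / 2) := by
  have h1 := sin_half_pos hθ hθπ
  have h2 := cos_arcPoint_half_pos hθ hθπ φ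
  have h3 := Real.sin_pos_of_mem_Ioo hφ
  rw [abs_neg, abs_of_pos (by positivity)]

theorem eq_withDensity_arcDensity {m : Measure ℝ} {θ : ℝ} (hθ : 0 < θ) (hθπ : θ < Real.pi)
    (hm : m (Icc (-θ) θ)ᶜ = 0) {h : ℝ → ℝ}
    (hκ : m.map (arcAngle θ) =
      (volume.restrict (Ioo 0 Real.pi)).withDensity fun φ => ENNReal.ofReal (h φ)) :
    m = volume.withDensity fun x => ENNReal.ofReal (arcDensity θ h x) := by
  have hβ : Measurable (arcPoint θ) := continuous_arcPoint.measurable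
  have hback : (m.map (arcAngle θ)).map (arcPoint θ) = m := by
    rw [Measure.map_map hβ measurable_arcAngle]
    have hid : arcPoint θ ∘ arcAngle θ =ᵐ[m] id := by
      filter_upwards [mem_ae_iff.2 hm] with y hy using arcPoint_arcAngle hθ hθπ hy
    rw [Measure.map_congr hid, Measure.map_id]
  ext A hA
  rw [withDensity_apply _ hA]
  have e1 : m A = ∫⁻ φ in Ioo 0 Real.pi,
      (arcPoint θ ⁻¹' A).indicator (fun φ => ENNReal.ofReal (h φ)) φ := by
    conv_lhs => rw [← hback]
    rw [Measure.map_apply hβ hA, hκ, withDensity_apply _ (hβ hA), lintegral_indicator (hβ hA)]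
  have e2 : ∫⁻ x in A, ENNReal.ofReal (arcDensity θ h x) =
      ∫⁻ x in arcPoint θ '' Ioo 0 Real.pi, A.indicator (fun x => ENNReal.ofReal
        (h (arcAngle θ x) * (Real.cos (x / 2) / (Real.sqrt 2 * chi θ x)))) x := by
    rw [image_arcPoint hθ hθπ, ← lintegral_indicator hA, ← lintegral_indicator measurableSet_Ioo]
    refine lintegral_congr fun x => ?_
    by_cases h1 : x ∈ A <;> by_cases h2 : x ∈ Ioo (-θ) θ <;> simp [arcDensity, h1, h2]
  rw [e1, e2, lintegral_image_eq_lintegral_abs_deriv_mul measurableSet_Ioo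
    (fun φ _ => (hasDerivAt_arcPoint hθ hθπ φ).hasDerivWithinAt)
    ((injOn_arcPoint hθ hθπ).mono Ioo_subset_Icc_self)]
  refine setLIntegral_congr_fun measurableSet_Ioo fun φ hφ => ?_
  have hφ' := Ioo_subset_Icc_self hφ
  have h1 := sin_half_pos hθ hθπ
  have h2 := cos_arcPoint_half_pos hθ hθπ φ
  have h3 := Real.sin_pos_of_mem_Ioo hφ
  by_cases hmem : arcPoint θ φ ∈ A
  · rw [indicator_of_mem (show φ ∈ arcPoint θ ⁻¹' A from hmem), indicator_of_mem hmem,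
      ← ENNReal.ofReal_mul (abs_nonneg _), abs_deriv_arcPoint hθ hθπ hφ,
      arcAngle_arcPoint hθ hθπ hφ', chi_arcPoint hθ hθπ hφ']
    congr 1
    have hs : Real.sqrt 2 * Real.sqrt 2 = 2 := Real.mul_self_sqrt (by norm_num)
    field_simp
    linear_combination h φ * hs
  · rw [indicator_of_notMem (show φ ∉ arcPoint θ ⁻¹' A from hmem), indicator_of_notMem hmem,
      mul_zero]

/-! ### The integral `P` -/

theorem exists_lipschitz_bound {g : ℝ → ℝ} {U : Set ℝ} (hU : IsOpen U) (hg : ContDiffOn ℝ 1 g U)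
    {a b : ℝ} (hab : Icc a b ⊆ U) :
    ∃ K : ℝ, ∀ x ∈ Icc a b, ∀ y ∈ Icc a b, |g y - g x| ≤ K * |y - x| := by
  have hc : ContinuousOn (deriv g) (Icc a b) := (hg.continuousOn_deriv_of_isOpen hU le_rfl).mono hab
  obtain ⟨K, hK⟩ := isCompact_Icc.exists_bound_of_continuousOn hc
  refine ⟨K, fun x hx y hy => ?_⟩
  exact (convex_Icc a b).norm_image_sub_le_of_norm_deriv_le (fun z hz =>
    (hg.differentiableOn one_ne_zero).differentiableAt (hU.mem_nhds (hab hz))) hK hx hy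

theorem abs_sub_le_mul_abs_sin_quarter {θ x y : ℝ} (hθπ : θ < Real.pi) (hx : x ∈ Icc (-θ) θ)
    (hy : y ∈ Icc (-θ) θ) : |y - x| ≤ 2 * Real.pi * |Real.sin ((y - x) / 4)| := by
  have h := Real.mul_abs_le_abs_sin (x := (y - x) / 4)
    (abs_le.2 ⟨by linarith [hx.2, hy.1], by linarith [hx.1, hy.2]⟩)
  rw [abs_div, abs_of_pos (by norm_num : (0 : ℝ) < 4)] at h
  have hπ := Real.pi_pos
  calc |y - x| = 2 * Real.pi * (2 / Real.pi * (|y - x| / 4)) := by field_simp; ring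
    _ ≤ _ := by gcongr

theorem abs_sub_le_mul_abs_sin_half {θ x y : ℝ} (hθπ : θ < Real.pi) (hx : x ∈ Icc (-θ) θ)
    (hy : y ∈ Icc (-θ) θ) :
    |y - x| ≤ Real.pi / Real.cos (θ / 2) * |Real.sin ((y - x) / 2)| := by
  have hθ : 0 ≤ θ := by linarith [hx.1, hx.2]
  have hc := Real.cos_pos_of_mem_Ioo (x := θ / 2) ⟨by linarith, by linarith⟩
  have h1 : Real.cos (θ / 2) ≤ |Real.cos ((y - x) / 4)| := by
    refine le_trans ?_ (le_abs_self _)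
    rw [← Real.cos_abs ((y - x) / 4)]
    refine Real.cos_le_cos_of_nonneg_of_le_pi (abs_nonneg _) (by linarith) (abs_le.2 ⟨?_, ?_⟩) <;>
      linarith [hx.1, hx.2, hy.1, hy.2]
  have h2 := abs_sub_le_mul_abs_sin_quarter hθπ hx hy
  have e : Real.sin ((y - x) / 2) = 2 * Real.sin ((y - x) / 4) * Real.cos ((y - x) / 4) := by
    rw [← Real.sin_two_mul]; ring_nf
  rw [e, abs_mul, abs_mul, abs_of_pos (by norm_num : (0 : ℝ) < 2), div_mul_eq_mul_div,
    le_div_iff₀ hc]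
  have hπ := Real.pi_pos
  calc |y - x| * Real.cos (θ / 2) ≤ 2 * Real.pi * |Real.sin ((y - x) / 4)| *
        |Real.cos ((y - x) / 4)| := by gcongr
    _ = _ := by ring

theorem abs_sub_le_mul_abs_sin_half_sub {θ x y : ℝ} (hθπ : θ < Real.pi) (hx : x ∈ Icc (-θ) θ)
    (hy : y ∈ Icc (-θ) θ) :
    |y - x| ≤ Real.pi / Real.cos (θ / 2) * |Real.sin (y / 2) - Real.sin (x / 2)| := by
  have hθ : 0 ≤ θ := by linarith [hx.1, hx.2]
  have hc := Real.cos_pos_of_mem_Ioo (x := θ / 2) ⟨by linarith, by linarith⟩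
  have h1 : Real.cos (θ / 2) ≤ |Real.cos ((y + x) / 4)| := by
    refine le_trans ?_ (le_abs_self _)
    rw [← Real.cos_abs ((y + x) / 4)]
    refine Real.cos_le_cos_of_nonneg_of_le_pi (abs_nonneg _) (by linarith) (abs_le.2 ⟨?_, ?_⟩) <;>
      linarith [hx.1, hx.2, hy.1, hy.2]
  have h2 := abs_sub_le_mul_abs_sin_quarter hθπ hx hy
  have e : Real.sin (y / 2) - Real.sin (x / 2) =
      2 * Real.sin ((y - x) / 4) * Real.cos ((y + x) / 4) := by
    rw [Real.sin_sub_sin]; ring_nf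
  rw [e, abs_mul, abs_mul, abs_of_pos (by norm_num : (0 : ℝ) < 2), div_mul_eq_mul_div,
    le_div_iff₀ hc]
  have hπ := Real.pi_pos
  calc |y - x| * Real.cos (θ / 2) ≤ 2 * Real.pi * |Real.sin ((y - x) / 4)| *
        |Real.cos ((y + x) / 4)| := by gcongr
    _ = _ := by ring

/-- A difference quotient of a Lipschitz function against a denominator comparable to the distance
is bounded, hence integrable after composition with `arcPoint θ`. -/
theorem intervalIntegrable_differenceQuotient {θ : ℝ} (hθ : 0 < θ) (hθπ : θ < Real.pi)
    {g d : ℝ → ℝ} {x K c : ℝ} (hx : x ∈ Icc (-θ) θ)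
    (hg : Continuous fun ψ => g (arcPoint θ ψ)) (hd : Continuous d)
    (hgK : ∀ x ∈ Icc (-θ) θ, ∀ y ∈ Icc (-θ) θ, |g y - g x| ≤ K * |y - x|)
    (hdc : ∀ y ∈ Icc (-θ) θ, |y - x| ≤ c * |d y|) :
    IntervalIntegrable (fun ψ => (g (arcPoint θ ψ) - g x) / d (arcPoint θ ψ)) volume 0 Real.pi := by
  have hmeas : Measurable fun ψ => (g (arcPoint θ ψ) - g x) / d (arcPoint θ ψ) :=
    (hg.measurable.sub_const _).div (hd.comp continuous_arcPoint).measurable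
  refine (intervalIntegrable_const (c := |K| * |c|)).mono_fun'
    hmeas.aestronglyMeasurable (Eventually.of_forall fun ψ => ?_)
  have hy := arcPoint_mem hθ hθπ ψ
  simp only [Real.norm_eq_abs, abs_div]
  refine div_le_of_le_mul₀ (abs_nonneg _) (by positivity) ?_
  calc _ ≤ K * |arcPoint θ ψ - x| := hgK x hx _ hy
    _ ≤ |K| * |arcPoint θ ψ - x| := by gcongr; exact le_abs_self _
    _ ≤ |K| * (|c| * |d (arcPoint θ ψ)|) := by
        gcongr
        exact (hdc _ hy).trans (by gcongr; exact le_abs_self _)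
    _ = _ := by ring

theorem abs_deriv_arcPoint_smul_integrandP {V : ℝ → ℝ} {θ : ℝ} (hθ : 0 < θ) (hθπ : θ < Real.pi)
    (x : ℝ) {ψ : ℝ} (hψ : ψ ∈ Ioo 0 Real.pi) :
    |(-(2 * Real.sin (θ / 2) * Real.sin ψ / Real.cos (arcPoint θ ψ / 2)))| •
      integrandP V θ x (arcPoint θ ψ) =
    (deriv (fun t => V (Real.cos t)) (arcPoint θ ψ) - deriv (fun t => V (Real.cos t)) x) /
      Real.sin ((arcPoint θ ψ - x) / 2) * (Real.sqrt 2 / Real.cos (arcPoint θ ψ / 2)) := by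
  have h1 := sin_half_pos hθ hθπ
  have h2 := cos_arcPoint_half_pos hθ hθπ ψ
  have h3 := Real.sin_pos_of_mem_Ioo hψ
  have hs : Real.sqrt 2 * Real.sqrt 2 = 2 := Real.mul_self_sqrt (by norm_num)
  rw [abs_deriv_arcPoint hθ hθπ hψ, integrandP, chi_arcPoint hθ hθπ (Ioo_subset_Icc_self hψ),
    smul_eq_mul, mul_left_comm]
  congr 1
  field_simp
  linear_combination -hs

theorem intervalIntegrable_reflect {g : ℝ → ℝ} (hg : IntervalIntegrable g volume 0 Real.pi) :
    IntervalIntegrable (fun ψ => g (Real.pi - ψ)) volume 0 Real.pi := by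
  simpa using (hg.comp_sub_left Real.pi).symm

theorem integral_eq_half_integral_reflect_add {g : ℝ → ℝ}
    (hg : IntervalIntegrable g volume 0 Real.pi) :
    ∫ ψ in (0 : ℝ)..Real.pi, g ψ =
      1 / 2 * ∫ ψ in (0 : ℝ)..Real.pi, (g ψ + g (Real.pi - ψ)) := by
  have h := intervalIntegral.integral_comp_sub_left g Real.pi (a := 0) (b := Real.pi)
  simp only [sub_self, sub_zero] at h
  rw [intervalIntegral.integral_add hg (intervalIntegrable_reflect hg), h]; ring

/-- Symmetrization identity behind the passage from the kernel `1 / sin ((y - x) / 2)` to the kernel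
`1 / (sin (y / 2) - sin (x / 2))`; here `A` and `B` are the values at `y` and `x` of an odd
function. -/
theorem symmetrized_kernel_identity {A B x y : ℝ} (hcx : Real.cos (x / 2) ≠ 0)
    (hcy : Real.cos (y / 2) ≠ 0) (hs : Real.sin ((y - x) / 2) ≠ 0)
    (hs' : Real.sin ((y + x) / 2) ≠ 0) :
    (A - B) / Real.sin ((y - x) / 2) / Real.cos (y / 2) +
      (-A - B) / Real.sin ((-y - x) / 2) / Real.cos (-y / 2) =
    Real.cos (x / 2) * ((A / Real.cos (y / 2) - B / Real.cos (x / 2)) /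
        (Real.sin (y / 2) - Real.sin (x / 2)) +
      (-A / Real.cos (-y / 2) - B / Real.cos (x / 2)) /
        (Real.sin (-y / 2) - Real.sin (x / 2))) := by
  have e := sin_half_sub_mul_sin_half_add y x
  have hprod := mul_ne_zero hs hs'
  rw [← e] at hprod
  have hd := left_ne_zero_of_mul hprod
  have hp := right_ne_zero_of_mul hprod
  have e1 : Real.sin ((-y - x) / 2) = -Real.sin ((y + x) / 2) := by
    rw [← Real.sin_neg]; ring_nf
  have e2 : Real.sin (-y / 2) - Real.sin (x / 2) = -(Real.sin (y / 2) + Real.sin (x / 2)) := by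
    rw [neg_div, Real.sin_neg]; ring
  have e3 : Real.cos (-y / 2) = Real.cos (y / 2) := by rw [neg_div, Real.cos_neg]
  rw [e1, e2, e3]
  have l1 : (A - B) / Real.sin ((y - x) / 2) / Real.cos (y / 2) +
      (-A - B) / -Real.sin ((y + x) / 2) / Real.cos (y / 2) =
      ((A - B) * Real.sin ((y + x) / 2) + (A + B) * Real.sin ((y - x) / 2)) /
        (Real.cos (y / 2) * (Real.sin ((y - x) / 2) * Real.sin ((y + x) / 2))) := by
    field_simp; ring
  have l2 : Real.cos (x / 2) * ((A / Real.cos (y / 2) - B / Real.cos (x / 2)) /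
        (Real.sin (y / 2) - Real.sin (x / 2)) +
      (-A / Real.cos (y / 2) - B / Real.cos (x / 2)) /
        -(Real.sin (y / 2) + Real.sin (x / 2))) =
      2 * (A * Real.sin (y / 2) * Real.cos (x / 2) - B * Real.cos (y / 2) * Real.sin (x / 2)) /
        (Real.cos (y / 2) * ((Real.sin (y / 2) - Real.sin (x / 2)) *
          (Real.sin (y / 2) + Real.sin (x / 2)))) := by
    field_simp; ring
  rw [l1, l2, e]
  congr 1
  rw [add_div y, sub_div y, Real.sin_add, Real.sin_sub]
  ring

section

variable {V : ℝ → ℝ} {θ : ℝ}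

theorem deriv_comp_cos_neg (V : ℝ → ℝ) (x : ℝ) :
    deriv (fun t => V (Real.cos t)) (-x) = -deriv (fun t => V (Real.cos t)) x := by
  have h := deriv_comp_neg (fun t => V (Real.cos t)) x
  simp only [Real.cos_neg] at h
  rw [h, neg_neg]

/-- The difference quotient of `reducedDeriv f ∘ arcPoint θ` with respect to the cosine. -/
def reducedQuotient (f : ℝ → ℝ) (θ x ψ : ℝ) : ℝ :=
  Real.sin (θ / 2) * ((reducedDeriv f (arcPoint θ ψ) - reducedDeriv f x) /
    (Real.sin (arcPoint θ ψ / 2) - Real.sin (x / 2)))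

theorem reducedQuotient_mul (hθ : 0 < θ) (hθπ : θ < Real.pi) (f : ℝ → ℝ) {φ : ℝ} :
    ∀ᵐ ψ ∂volume, ψ ∈ Ioc 0 Real.pi →
      reducedQuotient f θ (arcPoint θ φ) ψ * (Real.cos ψ - Real.cos φ) =
        reducedDeriv f (arcPoint θ ψ) - reducedDeriv f (arcPoint θ φ) := by
  filter_upwards [(ae_restrict_iff' measurableSet_Ioc).1 (ae_cos_ne_cos φ)] with ψ hψ hm
  have h1 : Real.cos ψ - Real.cos φ ≠ 0 := sub_ne_zero.2 (hψ hm)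
  have ha := (sin_half_pos hθ hθπ).ne'
  rw [reducedQuotient, sin_arcPoint_half hθ hθπ, sin_arcPoint_half hθ hθπ, ← mul_sub]
  field_simp

theorem intervalIntegrable_kernelP (hθ : 0 < θ) (hθπ : θ < Real.pi) {f : ℝ → ℝ} {U : Set ℝ}
    (hU : IsOpen U) (hθU : Icc (-θ) θ ⊆ U) (hf : ContDiffOn ℝ 3 f U) {x : ℝ}
    (hx : x ∈ Icc (-θ) θ) :
    IntervalIntegrable (fun ψ => (deriv f (arcPoint θ ψ) - deriv f x) /
      Real.sin ((arcPoint θ ψ - x) / 2) * (Real.sqrt 2 / Real.cos (arcPoint θ ψ / 2)))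
      volume 0 Real.pi := by
  have hf' : ContDiffOn ℝ 1 (deriv f) U := hf.deriv_of_isOpen hU (by norm_num)
  obtain ⟨K, hK⟩ := exists_lipschitz_bound hU hf' hθU
  have hcont : Continuous fun ψ => deriv f (arcPoint θ ψ) :=
    hf'.continuousOn.comp_continuous continuous_arcPoint fun ψ => hθU (arcPoint_mem hθ hθπ ψ)
  refine (intervalIntegrable_differenceQuotient (d := fun y => Real.sin ((y - x) / 2)) hθ hθπ hx
    hcont (by fun_prop) hK fun y hy => abs_sub_le_mul_abs_sin_half hθπ hx hy).mul_continuousOn ?_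
  exact (continuous_const.div (Real.continuous_cos.comp (continuous_arcPoint.div_const 2))
    fun ψ => (cos_arcPoint_half_pos hθ hθπ ψ).ne').continuousOn

theorem contDiffOn_reducedDeriv (hθπ : θ < Real.pi) {f : ℝ → ℝ} {U : Set ℝ}
    (hU : IsOpen U) (hθU : Icc (-θ) θ ⊆ U) (hf : ContDiffOn ℝ 3 f U) :
    ∃ W : Set ℝ, IsOpen W ∧ Icc (-θ) θ ⊆ W ∧ ContDiffOn ℝ 1 (reducedDeriv f) W := by
  refine ⟨U ∩ {x | Real.cos (x / 2) ≠ 0}, hU.inter (isOpen_ne_fun (by fun_prop) continuous_const),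
    fun x hx => ⟨hθU hx, (cos_half_pos_of_mem hθπ hx).ne'⟩, ?_⟩
  have hf' : ContDiffOn ℝ 1 (deriv f) U := hf.deriv_of_isOpen hU (by norm_num)
  have hc : ContDiff ℝ 1 fun x : ℝ => Real.cos (x / 2) := Real.contDiff_cos.comp (by fun_prop)
  exact (hf'.mono inter_subset_left).div hc.contDiffOn fun x hx => hx.2

theorem continuous_reducedDeriv_arcPoint (hθ : 0 < θ) (hθπ : θ < Real.pi) {f : ℝ → ℝ} {U : Set ℝ}
    (hU : IsOpen U) (hθU : Icc (-θ) θ ⊆ U) (hf : ContDiffOn ℝ 3 f U) :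
    Continuous fun φ => reducedDeriv f (arcPoint θ φ) := by
  obtain ⟨W, hW, hθW, hg⟩ := contDiffOn_reducedDeriv hθπ hU hθU hf
  exact hg.continuousOn.comp_continuous continuous_arcPoint fun ψ => hθW (arcPoint_mem hθ hθπ ψ)

theorem intervalIntegrable_reducedQuotient (hθ : 0 < θ) (hθπ : θ < Real.pi) {f : ℝ → ℝ}
    {U : Set ℝ} (hU : IsOpen U) (hθU : Icc (-θ) θ ⊆ U) (hf : ContDiffOn ℝ 3 f U) {x : ℝ}
    (hx : x ∈ Icc (-θ) θ) :
    IntervalIntegrable (reducedQuotient f θ x) volume 0 Real.pi := by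
  obtain ⟨W, hW, hθW, hg⟩ := contDiffOn_reducedDeriv hθπ hU hθU hf
  obtain ⟨K, hK⟩ := exists_lipschitz_bound hW hg hθW
  exact (intervalIntegrable_differenceQuotient
    (d := fun y => Real.sin (y / 2) - Real.sin (x / 2)) hθ hθπ hx
    (continuous_reducedDeriv_arcPoint hθ hθπ hU hθU hf) (by fun_prop) hK
    fun y hy => abs_sub_le_mul_abs_sin_half_sub hθπ hx hy).const_mul _

theorem intervalIntegrable_integrandP (hθ : 0 < θ) (hθπ : θ < Real.pi) {U : Set ℝ}
    (hU : IsOpen U) (hθU : Icc (-θ) θ ⊆ U) (hf : ContDiffOn ℝ 3 (fun t => V (Real.cos t)) U)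
    {x : ℝ} (hx : x ∈ Icc (-θ) θ) :
    IntervalIntegrable (integrandP V θ x) volume (-θ) θ := by
  rw [intervalIntegrable_iff_integrableOn_Ioo_of_le (by linarith), ← image_arcPoint hθ hθπ,
    integrableOn_image_iff_integrableOn_abs_deriv_smul measurableSet_Ioo
      (fun φ _ => (hasDerivAt_arcPoint hθ hθπ φ).hasDerivWithinAt)
      ((injOn_arcPoint hθ hθπ).mono Ioo_subset_Icc_self),
    integrableOn_congr_fun (fun ψ hψ => abs_deriv_arcPoint_smul_integrandP hθ hθπ x hψ)
      measurableSet_Ioo, ← intervalIntegrable_iff_integrableOn_Ioo_of_le Real.pi_pos.le]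
  exact intervalIntegrable_kernelP hθ hθπ hU hθU hf hx

/-- After the substitution `y = arcPoint θ ψ`, both integrals are symmetrized under `ψ ↦ π - ψ`, that
is, `y ↦ -y`, and their integrands then agree by `symmetrized_kernel_identity`. -/
theorem P_eq_integral_reducedQuotient (hθ : 0 < θ) (hθπ : θ < Real.pi) {U : Set ℝ}
    (hU : IsOpen U) (hθU : Icc (-θ) θ ⊆ U) (hf : ContDiffOn ℝ 3 (fun t => V (Real.cos t)) U)
    {x : ℝ} (hx : x ∈ Icc (-θ) θ) :
    P V θ x = Real.sqrt 2 * Real.cos (x / 2) / Real.sin (θ / 2) *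
      ∫ ψ in (0 : ℝ)..Real.pi, reducedQuotient (fun t => V (Real.cos t)) θ x ψ := by
  set f : ℝ → ℝ := fun t => V (Real.cos t) with hfdef
  have ha := (sin_half_pos hθ hθπ).ne'
  have hI := intervalIntegrable_kernelP hθ hθπ hU hθU hf hx
  have hQ := intervalIntegrable_reducedQuotient hθ hθπ hU hθU hf hx
  have h1 : P V θ x = ∫ ψ in (0 : ℝ)..Real.pi, (deriv f (arcPoint θ ψ) - deriv f x) /
      Real.sin ((arcPoint θ ψ - x) / 2) * (Real.sqrt 2 / Real.cos (arcPoint θ ψ / 2)) := by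
    rw [P, intervalIntegral.integral_of_le (by linarith), integral_Ioc_eq_integral_Ioo,
      ← image_arcPoint hθ hθπ,
      integral_image_eq_integral_abs_deriv_smul measurableSet_Ioo
        (fun φ _ => (hasDerivAt_arcPoint hθ hθπ φ).hasDerivWithinAt)
        ((injOn_arcPoint hθ hθπ).mono Ioo_subset_Icc_self),
      intervalIntegral.integral_of_le Real.pi_pos.le, integral_Ioc_eq_integral_Ioo]
    refine setIntegral_congr_fun measurableSet_Ioo fun ψ hψ => ?_
    exact abs_deriv_arcPoint_smul_integrandP hθ hθπ x hψ
  rw [h1, integral_eq_half_integral_reflect_add hI, integral_eq_half_integral_reflect_add hQ,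
    mul_left_comm,
    ← intervalIntegral.integral_const_mul (Real.sqrt 2 * Real.cos (x / 2) / Real.sin (θ / 2))]
  refine congrArg ((1 / 2 : ℝ) * ·) (intervalIntegral.integral_congr_ae ?_)
  rw [uIoc_of_le Real.pi_pos.le]
  have hne1 := (ae_restrict_iff' measurableSet_Ioc).1 (ae_cos_ne_cos (arcAngle θ x))
  have hne2 := (ae_restrict_iff' measurableSet_Ioc).1 (ae_cos_ne_cos (Real.pi - arcAngle θ x))
  filter_upwards [hne1, hne2] with ψ h2 h3 hm
  specialize h2 hm
  specialize h3 hm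
  have hcy := (cos_arcPoint_half_pos hθ hθπ ψ).ne'
  have hcx := (cos_half_pos_of_mem hθπ hx).ne'
  have hprod : Real.sin ((arcPoint θ ψ - x) / 2) * Real.sin ((arcPoint θ ψ + x) / 2) ≠ 0 := by
    rw [← sin_half_sub_mul_sin_half_add, sin_arcPoint_half hθ hθπ]
    have hsx : Real.sin (x / 2) = Real.sin (θ / 2) * Real.cos (arcAngle θ x) := by
      rw [cos_arcAngle hθ hθπ hx]; field_simp
    rw [hsx, ← mul_sub, ← mul_add]
    rw [Real.cos_pi_sub] at h3
    refine mul_ne_zero (mul_ne_zero ha (sub_ne_zero.2 h2)) (mul_ne_zero ha fun h0 => h3 ?_)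
    linarith
  have key := symmetrized_kernel_identity (A := deriv f (arcPoint θ ψ)) (B := deriv f x) hcx hcy
    (left_ne_zero_of_mul hprod) (right_ne_zero_of_mul hprod)
  simp only [reducedQuotient, reducedDeriv, arcPoint_pi_sub, hfdef, deriv_comp_cos_neg] at key ⊢
  field_simp at key ⊢
  linear_combination key

end

/-! ### Identification of the density -/

theorem frequently_nhdsLT_of_ae {p : ℝ → Prop} (hp : ∀ᵐ x ∂(volume : Measure ℝ), p x) (x : ℝ) :
    ∃ᶠ y in 𝓝[<] x, p y := by
  intro h
  obtain ⟨l, hl, hsub⟩ := mem_nhdsLT_iff_exists_Ioo_subset.1 h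
  have h0 : volume (Ioo l x) = 0 := measure_mono_null hsub (ae_iff.1 hp)
  exact (isOpen_Ioo.measure_pos volume (nonempty_Ioo.2 hl)).ne' h0

theorem frequently_nhdsGT_of_ae {p : ℝ → Prop} (hp : ∀ᵐ x ∂(volume : Measure ℝ), p x) (x : ℝ) :
    ∃ᶠ y in 𝓝[>] x, p y := by
  intro h
  obtain ⟨l, hl, hsub⟩ := mem_nhdsGT_iff_exists_Ioo_subset.1 h
  have h0 : volume (Ioo x l) = 0 := measure_mono_null hsub (ae_iff.1 hp)
  exact (isOpen_Ioo.measure_pos volume (nonempty_Ioo.2 hl)).ne' h0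

/-- If the density on the arc vanishes like a square root at an end of the arc, then `h`, which is
the density times a factor vanishing there, is zero at the corresponding end of `[0, π]`. -/
theorem eq_zero_of_tendsto_div_sqrt {θ e C : ℝ} {h ρ : ℝ → ℝ} {l : Filter ℝ} [l.NeBot]
    (hθπ : θ < Real.pi) (hh : Continuous h) (hle : l ≤ 𝓝 e) (hchi : chi θ e = 0)
    (hcos : Real.cos (e / 2) ≠ 0) (hl : ∀ᶠ x in l, x ∈ Ioo (-θ) θ) (hne : ∀ᶠ x in l, x ≠ e)
    (hC : Tendsto (fun x => ρ x / Real.sqrt |x - e|) l (𝓝 C))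
    (hfreq : ∃ᶠ x in l, ρ x = arcDensity θ h x) : h (arcAngle θ e) = 0 := by
  have h1 : Tendsto (fun x => h (arcAngle θ x)) l (𝓝 (h (arcAngle θ e))) :=
    ((hh.comp continuous_arcAngle).tendsto e).mono_left hle
  have h2 : Tendsto (fun x => ρ x / Real.sqrt |x - e| *
      (Real.sqrt |x - e| * (Real.sqrt 2 * chi θ x / Real.cos (x / 2)))) l (𝓝 0) := by
    have hc : ContinuousAt (fun x =>
        Real.sqrt |x - e| * (Real.sqrt 2 * chi θ x / Real.cos (x / 2))) e := by
      have := (continuous_chi θ).continuousAt (x := e)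
      refine ContinuousAt.mul (Continuous.continuousAt ?_) (ContinuousAt.div ?_ ?_ hcos)
      · exact (continuous_id.sub continuous_const).abs.sqrt
      · exact continuousAt_const.mul this
      · fun_prop
    have := hC.mul (hc.tendsto.mono_left hle)
    simpa [hchi] using this
  refine tendsto_nhds_unique_of_frequently_eq h1 h2 ?_
  refine (hfreq.and_eventually (hl.and hne)).mono ?_
  rintro x ⟨hx, hmem, hxe⟩
  have hs : Real.sqrt |x - e| ≠ 0 := (Real.sqrt_pos.2 (abs_pos.2 (sub_ne_zero.2 hxe))).ne'
  have hcx := (cos_half_pos_of_mem hθπ (Ioo_subset_Icc_self hmem)).ne'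
  have hχ := (chi_pos hθπ hmem).ne'
  have h2 : Real.sqrt 2 ≠ 0 := by positivity
  rw [hx, arcDensity, indicator_of_mem hmem]
  field_simp

theorem chi_self (θ : ℝ) : chi θ θ = 0 := by simp [chi]

theorem chi_neg_self (θ : ℝ) : chi θ (-θ) = 0 := by simp [chi]

/-- At every point, `arcDensity θ h` is continuous from at least one side: at the ends of the arc it
is continuous from outside. -/
theorem tendsto_arcDensity_left_or_right {θ : ℝ} (hθπ : θ < Real.pi) {h : ℝ → ℝ}
    (hh : Continuous h) (x : ℝ) :
    Tendsto (arcDensity θ h) (𝓝[<] x) (𝓝 (arcDensity θ h x)) ∨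
      Tendsto (arcDensity θ h) (𝓝[>] x) (𝓝 (arcDensity θ h x)) := by
  have hout : ∀ y, y ∉ Ioo (-θ) θ → arcDensity θ h y = 0 := fun y hy => indicator_of_notMem hy _
  rcases le_or_gt x (-θ) with h1 | h1
  · left
    rw [hout x fun hx => not_lt.2 h1 hx.1]
    refine tendsto_const_nhds.congr' ?_
    filter_upwards [self_mem_nhdsWithin] with y hy
    exact (hout y fun hy' => absurd hy'.1 (not_lt.2 ((le_of_lt hy).trans h1))).symm
  rcases le_or_gt θ x with h2 | h2
  · right
    rw [hout x fun hx => not_lt.2 h2 hx.2]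
    refine tendsto_const_nhds.congr' ?_
    filter_upwards [self_mem_nhdsWithin] with y hy
    exact (hout y fun hy' => absurd hy'.2 (not_lt.2 (h2.trans (le_of_lt hy)))).symm
  · left
    have hx : x ∈ Ioo (-θ) θ := ⟨h1, h2⟩
    have hc : ContinuousAt (fun x => h (arcAngle θ x) *
        (Real.cos (x / 2) / (Real.sqrt 2 * chi θ x))) x := by
      refine ContinuousAt.mul (hh.comp continuous_arcAngle).continuousAt
        (ContinuousAt.div (by fun_prop) ?_ ?_)
      · exact continuousAt_const.mul (continuous_chi θ).continuousAt
      · exact mul_ne_zero (by positivity) (chi_pos hθπ hx).ne'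
    have hev : (fun x => h (arcAngle θ x) * (Real.cos (x / 2) / (Real.sqrt 2 * chi θ x))) =ᶠ[𝓝 x]
        arcDensity θ h := by
      filter_upwards [isOpen_Ioo.mem_nhds hx] with y hy
      rw [arcDensity, indicator_of_mem hy]
    exact (hc.congr hev).tendsto.mono_left nhdsWithin_le_nhds

/-- The density obtained from the cosine series agrees with the integral formula, once the series
vanishes at both ends. -/
theorem arcDensity_cosSeries_eq_densityFormula {V : ℝ → ℝ} {θ : ℝ} (hθ : 0 < θ)
    (hθπ : θ < Real.pi) {U : Set ℝ} (hU : IsOpen U) (hθU : Icc (-θ) θ ⊆ U)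
    (hf : ContDiffOn ℝ 3 (fun t => V (Real.cos t)) U) {b : ℕ → ℝ}
    (hb : Summable fun n => ‖b (n + 1)‖)
    (hbR : ∀ n : ℕ, b (n + 1) = -(Real.sin (θ / 2) / (2 * Real.pi)) *
      ((∫ φ in (0 : ℝ)..Real.pi, reducedDeriv (fun t => V (Real.cos t)) (arcPoint θ φ) *
          Real.cos (n * φ)) -
        ∫ φ in (0 : ℝ)..Real.pi, reducedDeriv (fun t => V (Real.cos t)) (arcPoint θ φ) *
          Real.cos ((n + 2 : ℕ) * φ)))
    (h0 : cosSeries b 0 = 0) (hpi : cosSeries b Real.pi = 0) :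
    arcDensity θ (cosSeries b) = densityFormula V θ := by
  funext x
  by_cases hx : x ∈ Ioo (-θ) θ
  · have hx' := Ioo_subset_Icc_self hx
    rw [arcDensity, densityFormula, indicator_of_mem hx, indicator_of_mem hx',
      P_eq_integral_reducedQuotient hθ hθπ hU hθU hf hx']
    have hR := continuous_reducedDeriv_arcPoint hθ hθπ hU hθU hf
    have hxφ := arcPoint_arcAngle hθ hθπ hx'
    have key := cosSeries_eq_of_eq_zero (hR.intervalIntegrable _ _) hb hbR h0 hpi
      (intervalIntegrable_reducedQuotient hθ hθπ hU hθU hf (arcPoint_mem hθ hθπ (arcAngle θ x)))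
      (reducedQuotient_mul hθ hθπ (fun t => V (Real.cos t)))
    rw [hxφ] at key
    have hχ : chi θ x = Real.sqrt 2 * Real.sin (θ / 2) * Real.sin (arcAngle θ x) := by
      conv_lhs => rw [← hxφ]
      exact chi_arcPoint hθ hθπ (arcAngle_mem x)
    have ha := sin_half_pos hθ hθπ
    have hs := Real.sin_pos_of_mem_Ioo (arcAngle_mem_Ioo hθ hθπ hx)
    have h2 : Real.sqrt 2 ^ 2 = 2 := Real.sq_sqrt (by norm_num)
    have h4 : Real.sqrt 2 ^ 4 = 4 := by
      rw [show Real.sqrt 2 ^ 4 = (Real.sqrt 2 ^ 2) ^ 2 by ring, h2]; norm_num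
    have hπ := Real.pi_ne_zero
    rw [key, hχ]
    field_simp
    simp only [h4]
  · rw [arcDensity, indicator_of_notMem hx, densityFormula]
    by_cases hx' : x ∈ Icc (-θ) θ
    · have hχ : chi θ x = 0 := by
        rcases eq_or_lt_of_le hx'.1 with h | h
        · rw [← h]; exact chi_neg_self θ
        · rcases eq_or_lt_of_le hx'.2 with h' | h'
          · rw [h']; exact chi_self θ
          · exact absurd ⟨h, h'⟩ hx
      rw [indicator_of_mem hx', hχ]; ring
    · rw [indicator_of_notMem hx']

end UnitaryEquilibrium

end

open UnitaryEquilibrium in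
theorem mainTheorem4 (V : ℝ → ℝ) (hV : ContinuousOn V (Set.Icc (-1) 1))
    (m : MeasureTheory.Measure ℝ) (hm : UnitaryEquilibrium.IsEquilibriumMeasure V m)
    (ρ : ℝ → ℝ) (hρ : UnitaryEquilibrium.IsDensityVersion m ρ) (θ : ℝ)
    (hC1 : UnitaryEquilibrium.ConditionC1 m θ)
    (hC2 : UnitaryEquilibrium.ConditionC2 V m ρ θ)
    (hC3 : UnitaryEquilibrium.ConditionC3 V θ) :
    (∀ x ∈ Set.Icc (-θ) θ, IntervalIntegrable (UnitaryEquilibrium.integrandP V θ x)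
      MeasureTheory.volume (-θ) θ) ∧
    m = MeasureTheory.volume.withDensity
      (fun x => ENNReal.ofReal (UnitaryEquilibrium.densityFormula V θ x)) ∧
    (∀ᵐ x ∂MeasureTheory.volume, ρ x = UnitaryEquilibrium.densityFormula V θ x) ∧
    ∀ x : ℝ, ContinuousAt ρ x → ρ x = UnitaryEquilibrium.densityFormula V θ x := by
  obtain ⟨hθ, hθπ, hsupp⟩ := hC1
  obtain ⟨-, ⟨C, -, hCr, hCl⟩, hmin⟩ := hC2
  have hprob : IsProbabilityMeasure m := hm.1.1
  have hnull : m (Icc (-θ) θ)ᶜ = 0 := by rw [← hsupp]; exact Measure.measure_compl_support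
  obtain ⟨ε, hε, hf⟩ := hC3.exists_contDiffOn
  have hU : IsOpen (Ioo (-θ - ε) (θ + ε)) := isOpen_Ioo
  have hθU : Icc (-θ) θ ⊆ Ioo (-θ - ε) (θ + ε) := Icc_subset_Ioo (by linarith) (by linarith)
  have hfc : Continuous fun x => V (Real.cos x) :=
    hV.comp_continuous Real.continuous_cos fun x => ⟨Real.neg_one_le_cos x, Real.cos_le_one x⟩
  obtain ⟨ℓ, hpot⟩ := exists_hasLogPotentialOn hθ hθπ hmin
  have heven : m.map (fun x => -x) = m :=
    hpot.map_neg_eq hθ hθπ hnull ((hfc.sub continuous_const).div_const 2).continuousOn (by simp)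
  -- The cosine moments of `m` in the angular coordinate.
  set b : ℕ → ℝ := fun n => ∫ x, Real.cos (n * x) ∂(m.map (arcAngle θ)) with hbdef
  have hFc : Continuous fun φ => V (Real.cos (arcPoint θ φ)) := hfc.comp continuous_arcPoint
  have hbF : ∀ n : ℕ, n ≠ 0 → b n = -(n / (2 * Real.pi)) *
      ∫ φ in (0 : ℝ)..Real.pi, V (Real.cos (arcPoint θ φ)) * Real.cos (n * φ) := fun n hn =>
    integral_cos_arcAngle (f := fun x => V (Real.cos x)) hθ hθπ hnull heven hFc hpot hn
  have hdiff : ∀ x ∈ Icc (-θ) θ, DifferentiableAt ℝ (fun x => V (Real.cos x)) x := fun x hx =>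
    (hf.differentiableOn (by norm_num)).differentiableAt (hU.mem_nhds (hθU hx))
  have hR := continuous_reducedDeriv_arcPoint hθ hθπ hU hθU hf
  have hbR : ∀ n : ℕ, b (n + 1) = -(Real.sin (θ / 2) / (2 * Real.pi)) *
      ((∫ φ in (0 : ℝ)..Real.pi, reducedDeriv (fun t => V (Real.cos t)) (arcPoint θ φ) *
          Real.cos (n * φ)) -
        ∫ φ in (0 : ℝ)..Real.pi, reducedDeriv (fun t => V (Real.cos t)) (arcPoint θ φ) *
          Real.cos ((n + 2 : ℕ) * φ)) := by
    intro n
    have h1 := integral_comp_arcPoint_mul_cos hθ hθπ hdiff hR n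
    rw [hbF _ n.succ_ne_zero]
    linear_combination -(1 / (2 * Real.pi)) * h1
  have hb : Summable fun n => ‖b (n + 1)‖ := by
    have hF : ContDiff ℝ 3 fun φ => V (Real.cos (arcPoint θ φ)) :=
      hf.comp_contDiff (contDiff_arcPoint hθ hθπ) fun φ => hθU (arcPoint_mem hθ hθπ φ)
    have hF' : ∀ φ, Real.sin φ = 0 → deriv (fun φ => V (Real.cos (arcPoint θ φ))) φ = 0 := by
      intro φ hφ
      have := (hdiff _ (arcPoint_mem hθ hθπ φ)).hasDerivAt.comp φ (hasDerivAt_arcPoint hθ hθπ φ)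
      refine this.deriv.trans ?_
      rw [hφ]; simp
    obtain ⟨K, hK⟩ := exists_abs_integral_mul_cos_le hF (hF' 0 Real.sin_zero)
      (hF' Real.pi Real.sin_pi)
    have hsum : Summable fun n : ℕ => K / (2 * Real.pi) * (1 / ((n + 1 : ℕ) : ℝ) ^ 2) :=
      ((summable_nat_add_iff 1).2 (Real.summable_one_div_nat_pow.2 one_lt_two)).mul_left _
    refine Summable.of_nonneg_of_le (fun n => norm_nonneg _) (fun n => ?_) hsum
    have hn : (0 : ℝ) < ((n + 1 : ℕ) : ℝ) := by exact_mod_cast n.succ_pos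
    have hπ := Real.pi_pos
    rw [hbF _ n.succ_ne_zero, norm_mul, norm_neg, Real.norm_of_nonneg (by positivity)]
    calc _ ≤ ((n + 1 : ℕ) : ℝ) / (2 * Real.pi) * (K / ((n + 1 : ℕ) : ℝ) ^ 3) := by
          gcongr; exact hK _ n.succ_ne_zero
      _ = _ := by field_simp
  have hκprob : IsProbabilityMeasure (m.map (arcAngle θ)) :=
    Measure.isProbabilityMeasure_map measurable_arcAngle.aemeasurable
  have hκnull : (m.map (arcAngle θ)) (Icc 0 Real.pi)ᶜ = 0 := by
    rw [Measure.map_apply measurable_arcAngle measurableSet_Icc.compl]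
    have : arcAngle θ ⁻¹' (Icc 0 Real.pi)ᶜ = ∅ := by
      ext y
      simp only [mem_preimage, mem_compl_iff, mem_empty_iff_false, iff_false, not_not]
      exact arcAngle_mem y
    rw [this, measure_empty]
  obtain ⟨hκ, hnn⟩ := eq_withDensity_cosSeries hκnull hb fun n => rfl
  have hcont := continuous_cosSeries hb
  have hmD := eq_withDensity_arcDensity hθ hθπ hnull hκ
  have hDmeas : Measurable (arcDensity θ (cosSeries b)) := measurable_arcDensity hcont
  have hρD : ∀ᵐ x ∂volume, ρ x = arcDensity θ (cosSeries b) x := by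
    have h1 := Measure.rnDeriv_withDensity volume hDmeas.ennreal_ofReal
    rw [← hmD] at h1
    filter_upwards [hρ, h1] with x hx hx'
    rw [hx, hx', ENNReal.toReal_ofReal (arcDensity_nonneg hθπ hnn x)]
  -- The square-root behaviour of `ρ` excludes the solutions that are unbounded at the ends.
  have hcosθ : Real.cos (θ / 2) ≠ 0 := (cos_half_pos_of_mem hθπ ⟨by linarith, le_rfl⟩).ne'
  have h0 : cosSeries b 0 = 0 := by
    have := eq_zero_of_tendsto_div_sqrt hθπ hcont nhdsWithin_le_nhds (chi_self θ) hcosθ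
      (Ioo_mem_nhdsLT (by linarith)) (eventually_mem_nhdsWithin.mono fun x hx => ne_of_lt hx) hCr
      (frequently_nhdsLT_of_ae hρD θ)
    have hend : arcAngle θ θ = 0 := by
      have := arcAngle_arcPoint hθ hθπ ⟨le_rfl, Real.pi_pos.le⟩
      rwa [arcPoint_zero hθ hθπ] at this
    rwa [hend] at this
  have hpi : cosSeries b Real.pi = 0 := by
    have hend : arcPoint θ Real.pi = -θ := by
      rw [← sub_zero Real.pi, arcPoint_pi_sub, arcPoint_zero hθ hθπ]
    have := eq_zero_of_tendsto_div_sqrt (e := -θ) hθπ hcont nhdsWithin_le_nhds (chi_neg_self θ)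
      (by rwa [neg_div, Real.cos_neg])
      (Ioo_mem_nhdsGT (by linarith)) (eventually_mem_nhdsWithin.mono fun x hx => ne_of_gt hx)
      (by simpa only [sub_neg_eq_add] using hCl) (frequently_nhdsGT_of_ae hρD (-θ))
    rwa [← hend, arcAngle_arcPoint hθ hθπ ⟨Real.pi_pos.le, le_rfl⟩] at this
  have hD := arcDensity_cosSeries_eq_densityFormula hθ hθπ hU hθU hf hb hbR h0 hpi
  have hside := tendsto_arcDensity_left_or_right hθπ hcont
  rw [hD] at hmD hρD hside
  refine ⟨fun x hx => intervalIntegrable_integrandP hθ hθπ hU hθU hf hx, hmD, hρD,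
    fun x hx => ?_⟩
  rcases hside x with h | h
  · exact tendsto_nhds_unique_of_frequently_eq (hx.tendsto.mono_left nhdsWithin_le_nhds) h
      (frequently_nhdsLT_of_ae hρD x)
  · exact tendsto_nhds_unique_of_frequently_eq (hx.tendsto.mono_left nhdsWithin_le_nhds) h
      (frequently_nhdsGT_of_ae hρD x)
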